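/- Identify a language over $\{0,1\}$ with its characteristic function $f:\{0,1\}^*\to\{0,1\}$, and let $w_0,w_1,w_2,\dots$ be all words over $\{0,1\}$ in shortlex order. Fix an oracle $A\subseteq\{0,1\}^*$; all machines below are deterministic multitape Turing machines with an oracle for $A$. Let $\mathcal E^A=\bigcup_{c}\mathrm{DTIME}^A(2^{cn}+c)$. A partial function $\phi$ from $\{0,1\}^*$ to $\{0,1\}$ is \emph{uniform} if there is a positive integer $k$ such that for every word $w$ with $|w|\ge k$ there is a word $z$ with $|z|\le k\lfloor\log_2|w|\rfloor$ such that $\phi(wz)$ is defined. Let $\mathcal{UFP}^A$ be the class of all $f\in\mathcal E^A$ for which there is a uniform partial function $\phi$ such that $f$ agrees with $\phi$ wherever $\phi$ is defined and such that $\phi$ is computed by a machine with an oracle for $A$ that, for some $j$, halts within $|w|^j+j$ steps on every input $w$ at which $\phi$ is defined. A \emph{martingale} is a function $d:\{0,1\}^*\to[0,\infty)$ with $d(\lambda)>0$ for the empty word $\lambda$ and $d(\sigma)=\tfrac12\,(d(\sigma0)+d(\sigma1))$ for all $\sigma\in\{0,1\}^*$. It \emph{succeeds} on an infinite binary sequence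 $\alpha$ if $\limsup_{n\to\infty}d(\alpha[1,\dots,n])=\infty$, where $\alpha[1,\dots,n]$ is the initial segment of $\alpha$ of length $n$. A class $\mathcal C\subseteq\mathcal E^A$ has \emph{effective polynomial-time measure zero with respect to $A$ in $\mathcal E^A$} if there is a single martingale $d:\{0,1\}^*\to\mathbb Q\cap[0,\infty)$ that is computable in polynomial time by a Turing machine with an oracle for $A$ (a rational value being output as a binary numerator and denominator, not necessarily in lowest terms) and that succeeds on the characteristic sequence $f(w_0)f(w_1)f(w_2)\cdots$ of every $f\in\mathcal C$. \textbf{Theorem.} For every oracle $A\subseteq\{0,1\}^*$, the class $\mathcal{UFP}^A$ has effective polynomial-time measure zero with respect to $A$ in $\mathcal E^A$. -/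

import Mathlib

namespace OracleComplexity

/-! ### Oracle Turing machines

Words are elements of `List Bool`, with `false` and `true` for the letters 0 and 1; oracles are
languages `A : Language Bool`; a language under consideration is identified with its
characteristic function `List Bool → Bool`. -/

/-- The tape symbols of a machine with `m` auxiliary symbols: the blank, the bits, the rest. -/
inductive Symbol (m : ℕ) where
  | blank : Symbol m
  | bit (b : Bool) : Symbol m
  | aux (i : Fin m) : Symbol m
  deriving DecidableEq

instance (m : ℕ) : Inhabited (Symbol m) := ⟨Symbol.blank⟩

/-- Head movements. -/
inductive Move where
  | left : Move
  | stay : Move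
  | right : Move
  deriving DecidableEq

/-- Moving the head of a (two-way infinite) tape. -/
def Move.apply {Γ : Type} [Inhabited Γ] : Move → Turing.Tape Γ → Turing.Tape Γ
  | .left, T => T.move .left
  | .stay, T => T
  | .right, T => T.move .right

/-- The two types of instructions of an oracle machine with states `Q` and tape symbols `Γ`:
`act a d q` prints `a` on the scanned square, moves the head of the scanned tape by `d` and goes
to state `q`; `query yes no` goes to state `yes` or to state `no` according to whether the word
on the query tape belongs to the oracle. -/
inductive Instr (Q Γ : Type) where
  | act (a : Γ) (d : Move) (q : Q) : Instr Q Γ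
  | query (yes no : Q) : Instr Q Γ

/-- A deterministic multitape oracle Turing machine. It has `numTapes + 3` tapes: tape `0` holds
the input, tape `1` is the query tape, tape `2` is the output tape, and all of them, like the
others, can be used as work tapes. In state `q` the machine scans tape `scan q`; the instruction
that it carries out depends on the state and on the symbol scanned, and it halts when there is no
instruction. The oracle is not part of the machine. -/
structure OracleTM where
  numTapes : ℕ
  numStates : ℕ
  numAux : ℕ
  scan : Fin (numStates + 1) → Fin (numTapes + 3)
  instr : Fin (numStates + 1) → Symbol numAux →
    Option (Instr (Fin (numStates + 1)) (Symbol numAux))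

/-- `Holds T w`: the bits from the head of `T` to the right, up to the first square
that does not contain a bit, spell the word `w`. Every tape holds exactly one word. -/
def Holds {m : ℕ} (T : Turing.Tape (Symbol m)) (w : List Bool) : Prop :=
  (∀ (i : ℕ) (h : i < w.length), T.nth i = Symbol.bit w[i]) ∧
    ∀ b : Bool, T.nth w.length ≠ Symbol.bit b

namespace OracleTM

/-- A configuration: the state and the tapes (with their heads). -/
structure Cfg (M : OracleTM) where
  state : Fin (M.numStates + 1)
  tape : Fin (M.numTapes + 3) → Turing.Tape (Symbol M.numAux)

/-- The initial configuration: state `0`, the input on tape `0` with the head on its first letter,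
all other tapes blank. -/
def init (M : OracleTM) (x : List Bool) : M.Cfg where
  state := 0
  tape := fun t => if t = 0 then Turing.Tape.mk₁ (x.map Symbol.bit) else Turing.Tape.mk₁ []

open Classical in
/-- One step with oracle `A`; the value `none` means that the machine has halted. -/
noncomputable def step (M : OracleTM) (A : Language Bool) (c : M.Cfg) : Option M.Cfg :=
  match M.instr c.state (c.tape (M.scan c.state)).head with
  | none => none
  | some (.act a d q) =>
      some ⟨q, Function.update c.tape (M.scan c.state)
        (d.apply ((c.tape (M.scan c.state)).write a))⟩
  | some (.query yes no) =>
      some ⟨if ∃ w ∈ A, Holds (c.tape 1) w then yes else no, c.tape⟩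

/-- The configuration after `n` steps, if the machine has not halted before. -/
noncomputable def steps (M : OracleTM) (A : Language Bool) (n : ℕ) (c : M.Cfg) : Option M.Cfg :=
  (fun o : Option M.Cfg => o.bind (M.step A))^[n] (some c)

/-- `M.Outputs A x y t`: with oracle `A` and input `x`, the machine `M` halts after at most `t`
steps, and then the word on the output tape is `y`. -/
def Outputs (M : OracleTM) (A : Language Bool) (x y : List Bool) (t : ℕ) : Prop :=
  ∃ n ≤ t, ∃ c : M.Cfg, M.steps A n (M.init x) = some c ∧ M.step A c = none ∧ Holds (c.tape 2) y

end OracleTM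

/-! ### The classes `E^A` and `UFP^A` -/

/-- `E^A`, the union over `c` of `DTIME^A (2 ^ (c n) + c)`. -/
def StrictExp (A : Language Bool) : Set (List Bool → Bool) :=
  {f | ∃ (M : OracleTM) (c : ℕ), ∀ w, M.Outputs A w [f w] (2 ^ (c * w.length) + c)}

/-- The partial function `φ` is computed by a machine with oracle `A`, in polynomial time on the
inputs on which it is defined. -/
def PartialPolyTime (A : Language Bool) (φ : List Bool →. Bool) : Prop :=
  ∃ M : OracleTM, (∀ w b, b ∈ φ w ↔ ∃ t, M.Outputs A w [b] t) ∧
    ∃ j : ℕ, ∀ w b, b ∈ φ w → M.Outputs A w [b] (w.length ^ j + j)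

/-- `φ` is `k`-uniform (logarithms are rounded down, to base two). -/
def IsKUniform (k : ℕ) (φ : List Bool →. Bool) : Prop :=
  ∀ w : List Bool, k ≤ w.length →
    ∃ z : List Bool, z.length ≤ k * Nat.log 2 w.length ∧ (φ (w ++ z)).Dom

/-- `φ` is uniform: `k`-uniform for some positive integer `k`. -/
def IsUniform (φ : List Bool →. Bool) : Prop := ∃ k : ℕ, 0 < k ∧ IsKUniform k φ

/-- `φ ⊑ f`: the total function `f` agrees with `φ` wherever `φ` is defined. -/
def Extends (f : List Bool → Bool) (φ : List Bool →. Bool) : Prop := ∀ w, ∀ b ∈ φ w, f w = b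

/-- `UFP^A`. -/
def UFP (A : Language Bool) : Set (List Bool → Bool) :=
  {f | f ∈ StrictExp A ∧
    ∃ φ : List Bool →. Bool, PartialPolyTime A φ ∧ IsUniform φ ∧ Extends f φ}

/-! ### Effective polynomial-time measure -/

/-- The enumeration `λ, 0, 1, 00, 01, 10, 11, 000, …` of all words in shortlex order, starting at
index `0`: the word of index `n` is the binary numeral of `n + 1` without its leading digit. -/
def word (n : ℕ) : List Bool := (Nat.bits (n + 1)).dropLast.reverse

/-- The characteristic sequence of a language. -/
def charSeq (f : List Bool → Bool) : ℕ → Bool := fun n => f (word n)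

/-- The initial segment of length `n` of an infinite binary sequence. -/
def initSeg (α : ℕ → Bool) (n : ℕ) : List Bool := (List.range n).map α

/-- Martingales: nonnegative, with positive initial capital. -/
structure IsMartingale (d : List Bool → ℝ) : Prop where
  nonneg : ∀ σ, 0 ≤ d σ
  init_pos : 0 < d []
  fair : ∀ σ, d σ = (d (σ ++ [false]) + d (σ ++ [true])) / 2

/-- `d` succeeds on the sequence `α`: the upper limit of `d` along `α` is infinite. -/
def Succeeds (d : List Bool → ℝ) (α : ℕ → Bool) : Prop :=
  Filter.limsup (fun n => (d (initSeg α n) : EReal)) Filter.atTop = ⊤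

/-- The number with the given binary digits, least significant digit first. -/
def binValue (u : List Bool) : ℕ := Nat.ofDigits 2 (u.map Bool.toNat)

/-- `y` represents the rational number `q` as a fraction, not necessarily in lowest terms: a sign
bit, the binary numerator with every digit doubled, the separator `01`, the binary denominator. -/
def RepresentsRat (y : List Bool) (q : ℚ) : Prop :=
  ∃ (s : Bool) (u v : List Bool),
    y = s :: (u.flatMap (fun b => [b, b]) ++ [false, true] ++ v) ∧ binValue v ≠ 0 ∧
      q = (if s then -1 else 1) * (binValue u : ℚ) / (binValue v : ℚ)

/-- The rational-valued total function `d` is computable in polynomial time with oracle `A`. -/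
def RatPolyTime (A : Language Bool) (d : List Bool → ℚ) : Prop :=
  ∃ (M : OracleTM) (j : ℕ), ∀ x, ∃ y, RepresentsRat y (d x) ∧ M.Outputs A x y (x.length ^ j + j)

/-- `S` has effective polynomial-time measure zero with respect to `A`: some martingale
that is computable in polynomial time with oracle `A` succeeds on all sequences in `S`. -/
def MeasureZero (A : Language Bool) (S : Set (ℕ → Bool)) : Prop :=
  ∃ d : List Bool → ℚ, RatPolyTime A d ∧ IsMartingale (fun σ => (d σ : ℝ)) ∧
    ∀ α ∈ S, Succeeds (fun σ => (d σ : ℝ)) α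

/-- The class `C` has effective polynomial-time measure zero with respect to `A` in `E^A`. -/
def MeasureZeroInStrictExp (A : Language Bool) (C : Set (List Bool → Bool)) : Prop :=
  C ⊆ StrictExp A ∧ MeasureZero A (charSeq '' C)

end OracleComplexity

/-! A word `w` of index `n` satisfies `n + 1 ≥ 2 ^ |w|`, and a martingale that has read `n` bits may
use time polynomial in `n`. It can therefore run any given oracle machine on the next word for `n`
steps. For long words this is more than `|w| ^ j + j`, whatever `j` is. Let `f` extend a uniform `φ`
computed by `M`. Consider a gambler who runs `M` on the next word for `n` steps, stakes everything
on the bit that `M` outputs, and abstains if there is no such bit. This gambler never loses, because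
`f` agrees with `φ`. The domain of `φ` contains arbitrarily long words, so the gambler doubles the
capital infinitely often. The degree `j` need not be known in advance. To treat all machines with
one martingale, every word is read as the table of a machine. The gambler belonging to the word of
index `k` joins after bit `k` with capital `2 ^ (-(k + 1))`, taken from a reserve that is thereby
halved. The reserve plus all capitals is a martingale, and it dominates each gambler. After `n` bits
there are only `n` gamblers, each simulated for `n` steps, so its value is computable in polynomial
time with the oracle. Capitals are kept as integers in units of `2 ^ (-n)`. The computability claim
is proved for the concrete machine model. Stack programs are compiled to oracle machines
(`Exec.reaches`, `FP.exists_machine`). The functions that such programs compute in polynomial time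
on trees form a class `FP` closed under composition, branching, oracle tests and size-bounded
iteration (`FP.iterate`). This class contains a universal clocked simulation (`FP.sim`,
`sim_eq_iff`). Fairness and success are `isMartingale_martingale` and `succeeds_of_wins`. -/

namespace OracleComplexity

/-! ### Structured stack programs and their compilation to oracle machines -/

/-- The contents of the four stacks of a program. -/
abbrev Store := Fin 4 → List Bool

/-- Structured programs over four stacks of bits; the stack `1` is the query stack. -/
inductive Prog where
  | nop : Prog
  | push (k : Fin 4) (b : Bool) : Prog
  | seq (p q : Prog) : Prog
  /-- Pop the stack `k` and branch: it was empty, the bit was `0`, the bit was `1`. -/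
  | pop (k : Fin 4) (pe pf pt : Prog) : Prog
  /-- Pop the stack `k` until it is empty and run the program that belongs to the bit. -/
  | loop (k : Fin 4) (pf pt : Prog) : Prog
  /-- Branch according to whether the word on the query stack belongs to the oracle. -/
  | ask (p q : Prog) : Prog

/-- `Exec A p s s' t`: the program `p` transforms `s` into `s'` in time `t`. -/
inductive Exec (A : Language Bool) : Prog → Store → Store → ℕ → Prop
  | nop (s) : Exec A .nop s s 0
  | push (k b s) : Exec A (.push k b) s (Function.update s k (b :: s k)) 2
  | seq {p q s s' s'' t t'} : Exec A p s s' t → Exec A q s' s'' t' →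
      Exec A (.seq p q) s s'' (t + t')
  | pop_nil {k pe pf pt s s' t} : s k = [] → Exec A pe s s' t →
      Exec A (.pop k pe pf pt) s s' (t + 2)
  | pop_cons {k pe pf pt s s' t b l} : s k = b :: l →
      Exec A (if b then pt else pf) (Function.update s k l) s' t →
      Exec A (.pop k pe pf pt) s s' (t + 2)
  | loop_nil {k pf pt s} : s k = [] → Exec A (.loop k pf pt) s s 1
  | loop_cons {k pf pt s s' s'' t t' b l} : s k = b :: l →
      Exec A (if b then pt else pf) (Function.update s k l) s' t →
      Exec A (.loop k pf pt) s' s'' t' → Exec A (.loop k pf pt) s s'' (t + 2 + t')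
  | ask_yes {p q s s' t} : s 1 ∈ A → Exec A p s s' t → Exec A (.ask p q) s s' (t + 2)
  | ask_no {p q s s' t} : s 1 ∉ A → Exec A q s s' t → Exec A (.ask p q) s s' (t + 2)

/-- A line of code: the tape to be scanned and the instruction for each symbol. -/
abbrev Line := Fin 4 × (Symbol 0 → Instr ℕ (Symbol 0))

/-- The unconditional jump. -/
def Line.jump (n : ℕ) : Line := (0, fun a => .act a .stay n)

/-- Removing a bit and branching. -/
def Line.branch (k : Fin 4) (ne nf nt : ℕ) : Line :=
  -- A popped bit is not erased: it stays to the left of the head, where `TapeIs` does not look, and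
  -- a later push overwrites it.
  (k, fun a => match a with
    | .bit false => .act a .right nf
    | .bit true => .act a .right nt
    | _ => .act a .stay ne)

namespace Prog

/-- The number of lines of code of a program. -/
def len : Prog → ℕ
  | nop => 0
  | push _ _ => 2
  | seq p q => p.len + q.len
  | pop _ pe pf pt => 1 + (pe.len + (1 + (pf.len + (1 + pt.len))))
  | loop _ pf pt => 1 + (pf.len + (1 + (pt.len + 1)))
  | ask p q => 1 + (p.len + (1 + q.len))

/-- The code of a program, to be placed at the address `n`. -/
def code : Prog → ℕ → List Line
  | nop, _ => []
  -- An instruction prints before it moves, so a push needs two lines: move left leaving the scanned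
  -- symbol intact, then print.
  | push k b, n => [(k, fun a => .act a .left (n + 1)), (k, fun _ => .act (.bit b) .stay (n + 2))]
  | seq p q, n => p.code n ++ q.code (n + p.len)
  | pop k pe pf pt, n =>
      Line.branch k (n + 1) (n + 1 + pe.len + 1) (n + 1 + pe.len + 1 + pf.len + 1) ::
        (pe.code (n + 1) ++
          Line.jump (n + 1 + pe.len + 1 + pf.len + 1 + pt.len) ::
            (pf.code (n + 1 + pe.len + 1) ++
              Line.jump (n + 1 + pe.len + 1 + pf.len + 1 + pt.len) ::
                pt.code (n + 1 + pe.len + 1 + pf.len + 1)))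
  | loop k pf pt, n =>
      Line.branch k (n + 1 + pf.len + 1 + pt.len + 1) (n + 1) (n + 1 + pf.len + 1) ::
        (pf.code (n + 1) ++ Line.jump n :: (pt.code (n + 1 + pf.len + 1) ++ [Line.jump n]))
  | ask p q, n =>
      (1, fun _ => .query (n + 1) (n + 1 + p.len + 1)) ::
        (p.code (n + 1) ++
          Line.jump (n + 1 + p.len + 1 + q.len) :: q.code (n + 1 + p.len + 1))

theorem length_code (p : Prog) (n : ℕ) : (p.code n).length = p.len := by
  induction p generalizing n <;> simp_all [code, len] <;> omega

end Prog

/-- An instruction with its states renamed. -/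
def Instr.mapState {Q Q' Γ : Type} (f : Q → Q') : Instr Q Γ → Instr Q' Γ
  | .act a d q => .act a d (f q)
  | .query yes no => .query (f yes) (f no)

/-- The machine with the given code. -/
def machine (P : List Line) : OracleTM where
  numTapes := 1
  -- There are `P.length + 1` states; the last one is the address just past the code, which has no
  -- line and so halts.
  numStates := P.length
  numAux := 0
  scan q := (P[q.val]?.map Prod.fst).getD 0
  instr q a := P[q.val]?.map fun l => (l.2 a).mapState (Fin.ofNat (P.length + 1))

/-- The squares from the head of `T` to the right contain the word `l`, followed by blanks. -/
def TapeIs (T : Turing.Tape (Symbol 0)) (l : List Bool) : Prop :=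
  ∀ i : ℕ, T.nth i = (l[i]?).elim Symbol.blank Symbol.bit

/-! ### Tapes as stacks -/

theorem TapeIs.head_nil {T : Turing.Tape (Symbol 0)} (h : TapeIs T []) : T.head = .blank := by
  simpa using h 0

theorem TapeIs.head_cons {T : Turing.Tape (Symbol 0)} {b : Bool} {l : List Bool}
    (h : TapeIs T (b :: l)) : T.head = .bit b := by
  simpa using h 0

theorem TapeIs.tail {T : Turing.Tape (Symbol 0)} {b : Bool} {l : List Bool}
    (h : TapeIs T (b :: l)) : TapeIs (T.move .right) l := by
  intro i
  have := h (i + 1)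
  rw [Turing.Tape.move_right_nth]
  simpa using this

theorem TapeIs.cons {T : Turing.Tape (Symbol 0)} {l : List Bool} (h : TapeIs T l) (b : Bool) :
    TapeIs ((T.move .left).write (.bit b)) (b :: l) := by
  intro i
  rw [Turing.Tape.write_nth, Turing.Tape.move_left_nth]
  cases i with
  | zero => simp
  | succ i =>
    have := h i
    have h0 : ((i : ℤ) + 1) ≠ 0 := by omega
    simp [h0, this]

theorem TapeIs.mk₁ (x : List Bool) : TapeIs (Turing.Tape.mk₁ (x.map Symbol.bit)) x := by
  intro i
  cases i with
  | zero => cases x <;> simp [Turing.Tape.mk₁, Turing.Tape.mk₂, Turing.Tape.mk', default]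
  | succ i =>
    rw [Turing.Tape.mk₁, Turing.Tape.mk₂, Turing.Tape.mk']
    change (Turing.ListBlank.nth (Turing.ListBlank.mk (x.map Symbol.bit)).tail i) = _
    cases x with
    | nil => simp [Turing.ListBlank.nth_mk, default, Turing.ListBlank.tail_mk]
    | cons b l =>
      simp only [List.map_cons, Turing.ListBlank.tail_mk, List.tail_cons,
        Turing.ListBlank.nth_mk, List.getElem?_cons_succ]
      rw [List.getI_eq_getElem?_getD]
      cases h : l[i]? <;> simp [h, default]

theorem TapeIs.holds_iff {T : Turing.Tape (Symbol 0)} {l : List Bool} (h : TapeIs T l)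
    (w : List Bool) : Holds T w ↔ w = l := by
  constructor
  · rintro ⟨h1, h2⟩
    have hle : l.length ≤ w.length := by
      by_contra hlt
      push Not at hlt
      apply h2 l[w.length]
      rw [h, List.getElem?_eq_getElem hlt]; rfl
    apply List.ext_getElem?
    intro i
    by_cases hi : i < w.length
    · have := h1 i hi
      rw [h] at this
      rw [List.getElem?_eq_getElem hi]
      cases hl : l[i]? with
      | none => simp [hl] at this
      | some b => simp [hl] at this; simp [this]
    · rw [List.getElem?_eq_none (by omega), List.getElem?_eq_none (by omega)]
  · rintro rfl
    constructor
    · intro i hi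
      rw [h, List.getElem?_eq_getElem hi]; rfl
    · intro b
      rw [h, List.getElem?_eq_none le_rfl]
      simp

variable {A : Language Bool} {P : List Line}

/-- The tapes of a configuration. -/
def tapes (c : (machine P).Cfg) : Fin 4 → Turing.Tape (Symbol 0) := c.tape

/-- The configuration `c` of the machine is at the line `n` with the stacks `s`. -/
def At (c : (machine P).Cfg) (n : ℕ) (s : Store) : Prop :=
  c.state.val = n ∧ ∀ k, TapeIs (tapes c k) (s k)

/-! ### Composition of runs -/

namespace OracleTM

variable (M : OracleTM) (A : Language Bool)

theorem steps_zero (c : M.Cfg) : M.steps A 0 c = some c := rfl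

theorem iterate_step_none (n : ℕ) :
    (fun o : Option M.Cfg => o.bind (M.step A))^[n] none = none := by
  induction n with
  | zero => rfl
  | succ n ih => rw [Function.iterate_succ_apply, Option.bind_none, ih]

theorem steps_succ (n : ℕ) (c : M.Cfg) :
    M.steps A (n + 1) c = (M.step A c).bind (M.steps A n) := by
  unfold steps
  rw [Function.iterate_succ_apply, Option.bind_some]
  cases M.step A c with
  | none => rw [iterate_step_none]; rfl
  | some c' => rfl

theorem steps_add {m n : ℕ} {c c' c'' : M.Cfg} (h : M.steps A m c = some c')
    (h' : M.steps A n c' = some c'') : M.steps A (m + n) c = some c'' := by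
  unfold steps at *
  rw [Nat.add_comm, Function.iterate_add_apply, h, h']

end OracleTM

/-- Reaching line `n'` with stacks `s'` within `t` steps from any configuration at line `n` with
stacks `s`. -/
def Reaches (A : Language Bool) (P : List Line) (n : ℕ) (s : Store) (n' : ℕ) (s' : Store)
    (t : ℕ) : Prop :=
  ∀ c : (machine P).Cfg, At c n s →
    ∃ m ≤ t, ∃ c', (machine P).steps A m c = some c' ∧ At c' n' s'

theorem Reaches.refl (n : ℕ) (s : Store) (t : ℕ) : Reaches A P n s n s t :=
  fun c h => ⟨0, Nat.zero_le _, c, rfl, h⟩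

theorem Reaches.trans {n n' n'' : ℕ} {s s' s'' : Store} {t t' : ℕ}
    (h : Reaches A P n s n' s' t) (h' : Reaches A P n' s' n'' s'' t') :
    Reaches A P n s n'' s'' (t + t') := by
  intro c hc
  obtain ⟨m, hm, c', h1, h2⟩ := h c hc
  obtain ⟨m', hm', c'', h3, h4⟩ := h' c' h2
  exact ⟨m + m', by omega, c'', OracleTM.steps_add _ _ h1 h3, h4⟩

theorem Reaches.mono {n n' : ℕ} {s s' : Store} {t t' : ℕ} (h : Reaches A P n s n' s' t)
    (ht : t ≤ t') : Reaches A P n s n' s' t' := by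
  intro c hc
  obtain ⟨m, hm, h⟩ := h c hc
  exact ⟨m, hm.trans ht, h⟩

/-- The bound on `n'` makes the reduction of addresses modulo `P.length + 1` in `machine` harmless.
-/
theorem step_act {n : ℕ} {c : (machine P).Cfg} {l : Line} (hc : c.state.val = n)
    (hl : P[n]? = some l) {a : Symbol 0} {d : Move} {n' : ℕ} (hn' : n' ≤ P.length)
    (h : l.2 (tapes c l.1).head = .act a d n') :
    ∃ c', (machine P).step A c = some c' ∧ c'.state.val = n' ∧
      tapes c' = Function.update (tapes c) l.1 (d.apply ((tapes c l.1).write a)) := by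
  subst hc
  have hs : (P[c.state.val]?.map Prod.fst).getD 0 = l.1 := by simp [hl]
  have hi : (machine P).instr c.state (c.tape ((machine P).scan c.state)).head
      = some (.act a d (Fin.ofNat (P.length + 1) n')) := by
    change P[c.state.val]?.map (fun l => (l.2 (tapes c
      ((P[c.state.val]?.map Prod.fst).getD 0)).head).mapState (Fin.ofNat (P.length + 1))) = _
    rw [hs, hl, Option.map_some, h]
    rfl
  refine ⟨⟨Fin.ofNat (P.length + 1) n', Function.update c.tape ((machine P).scan c.state)
      (d.apply ((c.tape ((machine P).scan c.state)).write a))⟩, ?_, ?_, ?_⟩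
  · unfold OracleTM.step
    rw [hi]
  · simp [Nat.mod_eq_of_lt (Nat.lt_succ_of_le hn')]
  · change Function.update (tapes c) ((P[c.state.val]?.map Prod.fst).getD 0)
      (d.apply ((tapes c ((P[c.state.val]?.map Prod.fst).getD 0)).write a)) = _
    rw [hs]

theorem step_query {n : ℕ} {c : (machine P).Cfg} {l : Line} {s : Store} (hc : At c n s)
    (hl : P[n]? = some l) {n₁ n₂ : ℕ} (h₁ : n₁ ≤ P.length) (h₂ : n₂ ≤ P.length)
    (h : ∀ a, l.2 a = .query n₁ n₂) :
    ∃ c', (machine P).step A c = some c' ∧ (s 1 ∈ A → At c' n₁ s) ∧ (s 1 ∉ A → At c' n₂ s) := by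
  obtain ⟨rfl, hT⟩ := hc
  have hi : (machine P).instr c.state (c.tape ((machine P).scan c.state)).head
      = some (.query (Fin.ofNat (P.length + 1) n₁) (Fin.ofNat (P.length + 1) n₂)) := by
    simp only [machine] at hl ⊢
    rw [hl, Option.map_some, h]
    rfl
  have hA : (∃ w ∈ A, Holds (c.tape 1) w) ↔ s 1 ∈ A := by
    constructor
    · rintro ⟨w, hw, hh⟩
      rwa [← ((hT 1).holds_iff w).1 hh]
    · exact fun hw => ⟨_, hw, ((hT 1).holds_iff _).2 rfl⟩
  classical
  have hst : (machine P).step A c = some ⟨if s 1 ∈ A then Fin.ofNat (P.length + 1) n₁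
      else Fin.ofNat (P.length + 1) n₂, c.tape⟩ := by
    unfold OracleTM.step
    rw [hi]
    by_cases hw : s 1 ∈ A
    · simp [hw, hA.2 hw]
    · have hw' := mt hA.1 hw
      simp [hw, hw']
  refine ⟨_, hst, fun hw => ⟨?_, hT⟩, fun hw => ⟨?_, hT⟩⟩
  · simp [hw, Nat.mod_eq_of_lt (Nat.lt_succ_of_le h₁)]
  · simp [hw, Nat.mod_eq_of_lt (Nat.lt_succ_of_le h₂)]

theorem Reaches.of_step {n n' : ℕ} {s s' : Store}
    (h : ∀ c : (machine P).Cfg, At c n s →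
      ∃ c', (machine P).step A c = some c' ∧ At c' n' s') : Reaches A P n s n' s' 1 := by
  intro c hc
  obtain ⟨c', h1, h2⟩ := h c hc
  exact ⟨1, le_rfl, c', by rw [OracleTM.steps_succ, h1]; rfl, h2⟩

theorem write_head (T : Turing.Tape (Symbol 0)) : T.write T.head = T := by
  cases T; rfl

theorem reaches_jump {n n' : ℕ} (hl : P[n]? = some (.jump n')) (hn' : n' ≤ P.length) (s : Store) :
    Reaches A P n s n' s 1 := by
  refine Reaches.of_step fun c hc => ?_
  obtain ⟨c', h1, h2, h3⟩ := step_act (A := A) hc.1 hl hn' (a := (tapes c 0).head) (d := .stay) rfl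
  refine ⟨c', h1, h2, ?_⟩
  have : tapes c' = tapes c := by
    rw [h3]
    simp only [Line.jump, Move.apply, write_head]
    exact Function.update_eq_self _ _
  rw [this]
  exact hc.2

theorem reaches_branch_nil {n : ℕ} {k : Fin 4} {ne nf nt : ℕ}
    (hl : P[n]? = some (.branch k ne nf nt)) (h : ne ≤ P.length) {s : Store} (hs : s k = []) :
    Reaches A P n s ne s 1 := by
  refine Reaches.of_step fun c hc => ?_
  have hk := hc.2 k
  rw [hs] at hk
  obtain ⟨c', h1, h2, h3⟩ := step_act (A := A) hc.1 hl h (a := (tapes c k).head) (d := .stay)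
    (by simp only [Line.branch]; rw [hk.head_nil])
  refine ⟨c', h1, h2, ?_⟩
  have : tapes c' = tapes c := by
    rw [h3]
    simp only [Line.branch, Move.apply, write_head]
    exact Function.update_eq_self _ _
  rw [this]
  exact hc.2

theorem reaches_branch_cons {n : ℕ} {k : Fin 4} {ne nf nt : ℕ}
    (hl : P[n]? = some (.branch k ne nf nt)) (hf : nf ≤ P.length) (ht : nt ≤ P.length)
    {s : Store} {b : Bool} {l : List Bool} (hs : s k = b :: l) :
    Reaches A P n s (if b then nt else nf) (Function.update s k l) 1 := by
  refine Reaches.of_step fun c hc => ?_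
  have hk := hc.2 k
  rw [hs] at hk
  obtain ⟨c', h1, h2, h3⟩ := step_act (A := A) hc.1 hl (n' := if b then nt else nf)
    (by split <;> assumption) (a := (tapes c k).head) (d := .right)
    (by simp only [Line.branch]; rw [hk.head_cons]; cases b <;> rfl)
  refine ⟨c', h1, h2, fun j => ?_⟩
  rw [h3]
  simp only [Line.branch, Move.apply, write_head]
  by_cases hj : j = k
  · subst hj
    rw [Function.update_self, Function.update_self]
    exact hk.tail
  · rw [Function.update_of_ne hj, Function.update_of_ne hj]
    exact hc.2 j

theorem reaches_push {n : ℕ} {k : Fin 4} {b : Bool}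
    (hl : P[n]? = some (k, fun a => .act a .left (n + 1)))
    (hl' : P[n + 1]? = some (k, fun _ => .act (.bit b) .stay (n + 2))) (s : Store) :
    Reaches A P n s (n + 2) (Function.update s k (b :: s k)) 2 := by
  have hlen : n + 1 < P.length := by
    by_contra hlt
    rw [List.getElem?_eq_none (by omega)] at hl'
    cases hl'
  intro c hc
  obtain ⟨c', h1, h2, h3⟩ := step_act (A := A) hc.1 hl (by omega) (a := (tapes c k).head)
    (d := .left) rfl
  obtain ⟨c'', h4, h5, h6⟩ := step_act (A := A) h2 hl' (by omega) (a := .bit b) (d := .stay) rfl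
  refine ⟨2, le_rfl, c'', ?_, h5, fun j => ?_⟩
  · rw [OracleTM.steps_succ, h1, Option.bind_some, OracleTM.steps_succ, h4]; rfl
  · rw [h6, h3]
    simp only [Move.apply, write_head]
    by_cases hj : j = k
    · subst hj
      rw [Function.update_self, Function.update_self, Function.update_self]
      exact (hc.2 j).cons b
    · rw [Function.update_of_ne hj, Function.update_of_ne hj, Function.update_of_ne hj]
      exact hc.2 j

theorem getElem?_append_cons_of_eq {α : Type*} (l : List α) (a : α) (l' : List α) {n : ℕ}
    (hn : n = l.length) : (l ++ a :: l')[n]? = some a := by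
  subst hn; simp

/-- Induction on the execution. Jumps are to absolute addresses, so the claim is made for the code
placed between arbitrary `pre` and `post`. In each case the surrounding code is regrouped so that a
subprogram again sits between two such pieces; after a round of a loop, the jump back leads to the
same loop at the same place. -/
theorem Exec.reaches {p : Prog} {s s' : Store} {t : ℕ} (h : Exec A p s s' t) :
    ∀ (pre post : List Line) (n : ℕ), n = pre.length →
      Reaches A (pre ++ (p.code n ++ post)) n s (n + p.len) s' t := by
  induction h with
  | nop s => intro pre post n hn; exact Reaches.refl _ _ _
  | push k b s =>
    intro pre post n hn
    refine reaches_push ?_ ?_ s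
    · exact getElem?_append_cons_of_eq _ _ _ hn
    · have := getElem?_append_cons_of_eq (pre ++ [(k, fun a => .act a .left (n + 1))])
        ((k, fun _ => .act (.bit b) .stay (n + 2)) : Line) post (n := n + 1) (by simp [hn])
      simpa [Prog.code] using this
  | @seq p q s s' s'' t t' h h' ih ih' =>
    intro pre post n hn
    have h1 := ih pre (q.code (n + p.len) ++ post) n hn
    have h2 := ih' (pre ++ p.code n) post (n + p.len) (by simp [hn, Prog.length_code])
    rw [← List.append_assoc pre] at h1
    simp only [Prog.code, Prog.len, List.append_assoc] at h1 h2 ⊢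
    rw [← Nat.add_assoc]
    exact h1.trans h2
  | @pop_nil k pe pf pt s s' t hs h ih =>
    intro pre post n hn
    set P := pre ++ ((Prog.pop k pe pf pt).code n ++ post) with hP
    have hPl : P.length = n + (Prog.pop k pe pf pt).len + post.length := by
      simp [hP, Prog.length_code, hn]; omega
    simp only [Prog.len] at hPl
    have h0 : P[n]? = some (Line.branch k (n + 1) (n + 1 + pe.len + 1)
        (n + 1 + pe.len + 1 + pf.len + 1)) := by
      rw [hP, Prog.code]; exact getElem?_append_cons_of_eq _ _ _ hn
    have h1 := reaches_branch_nil (A := A) h0 (by omega) hs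
    set P₁ := pre ++ [Line.branch k (n + 1) (n + 1 + pe.len + 1)
        (n + 1 + pe.len + 1 + pf.len + 1)] with hP₁
    set P₂ := Line.jump (n + 1 + pe.len + 1 + pf.len + 1 + pt.len) ::
            (pf.code (n + 1 + pe.len + 1) ++
              Line.jump (n + 1 + pe.len + 1 + pf.len + 1 + pt.len) ::
                pt.code (n + 1 + pe.len + 1 + pf.len + 1)) ++ post with hP₂
    have hPe : P = P₁ ++ (pe.code (n + 1) ++ P₂) := by
      simp [hP, hP₁, hP₂, Prog.code]
    have h2 := ih P₁ P₂ (n + 1) (by simp [hP₁, hn])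
    rw [← hPe] at h2
    have h3 : P[n + 1 + pe.len]? = some (Line.jump (n + 1 + pe.len + 1 + pf.len + 1 + pt.len)) := by
      rw [hPe, hP₂, ← List.append_assoc, List.cons_append]
      exact getElem?_append_cons_of_eq _ _ _ (by simp [hP₁, hn, Prog.length_code]; try omega)
    have h4 := reaches_jump (A := A) h3 (by omega) s'
    have h5 := (h1.trans h2).trans h4
    simp only [Prog.len]
    convert h5.mono (t' := t + 2) (by omega) using 1
    omega
  | @pop_cons k pe pf pt s s' t b l hs h ih =>
    intro pre post n hn
    set P := pre ++ ((Prog.pop k pe pf pt).code n ++ post) with hP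
    have hPl : P.length = n + (Prog.pop k pe pf pt).len + post.length := by
      simp [hP, Prog.length_code, hn]; omega
    simp only [Prog.len] at hPl
    have h0 : P[n]? = some (Line.branch k (n + 1) (n + 1 + pe.len + 1)
        (n + 1 + pe.len + 1 + pf.len + 1)) := by
      rw [hP, Prog.code]; exact getElem?_append_cons_of_eq _ _ _ hn
    have h1 := reaches_branch_cons (A := A) h0 (by omega) (by omega) hs
    have hPe : P = pre ++ Line.branch k (n + 1) (n + 1 + pe.len + 1)
        (n + 1 + pe.len + 1 + pf.len + 1) :: (pe.code (n + 1) ++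
          Line.jump (n + 1 + pe.len + 1 + pf.len + 1 + pt.len) ::
            (pf.code (n + 1 + pe.len + 1) ++
              Line.jump (n + 1 + pe.len + 1 + pf.len + 1 + pt.len) ::
                (pt.code (n + 1 + pe.len + 1 + pf.len + 1) ++ post))) := by
      simp [hP, Prog.code]
    simp only [Prog.len]
    cases b with
    | false =>
      set P₁ := pre ++ Line.branch k (n + 1) (n + 1 + pe.len + 1)
        (n + 1 + pe.len + 1 + pf.len + 1) :: (pe.code (n + 1) ++
          [Line.jump (n + 1 + pe.len + 1 + pf.len + 1 + pt.len)]) with hP₁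
      set P₂ := Line.jump (n + 1 + pe.len + 1 + pf.len + 1 + pt.len) ::
                (pt.code (n + 1 + pe.len + 1 + pf.len + 1) ++ post) with hP₂
      have hPe' : P = P₁ ++ (pf.code (n + 1 + pe.len + 1) ++ P₂) := by
        rw [hPe, hP₁, hP₂]; simp
      have h2 := ih P₁ P₂ (n + 1 + pe.len + 1)
        (by simp [hP₁, hn, Prog.length_code]; omega)
      simp only [Bool.false_eq_true, if_false] at h1 h2
      rw [← hPe'] at h2
      have h3 : P[n + 1 + pe.len + 1 + pf.len]? =
          some (Line.jump (n + 1 + pe.len + 1 + pf.len + 1 + pt.len)) := by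
        rw [hPe', hP₂, ← List.append_assoc]
        exact getElem?_append_cons_of_eq _ _ _ (by simp [hP₁, hn, Prog.length_code]; omega)
      have h4 := reaches_jump (A := A) h3 (by omega) s'
      have h5 := (h1.trans h2).trans h4
      convert h5.mono (t' := t + 2) (by omega) using 1
      omega
    | true =>
      set P₁ := pre ++ Line.branch k (n + 1) (n + 1 + pe.len + 1)
        (n + 1 + pe.len + 1 + pf.len + 1) :: (pe.code (n + 1) ++
          Line.jump (n + 1 + pe.len + 1 + pf.len + 1 + pt.len) ::
            (pf.code (n + 1 + pe.len + 1) ++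
              [Line.jump (n + 1 + pe.len + 1 + pf.len + 1 + pt.len)])) with hP₁
      have hPe' : P = P₁ ++ (pt.code (n + 1 + pe.len + 1 + pf.len + 1) ++ post) := by
        rw [hPe, hP₁]; simp
      have h2 := ih P₁ post (n + 1 + pe.len + 1 + pf.len + 1)
        (by simp [hP₁, hn, Prog.length_code]; omega)
      simp only [if_true] at h1 h2
      rw [← hPe'] at h2
      have h5 := h1.trans h2
      convert h5.mono (t' := t + 2) (by omega) using 1
      omega
  | @loop_nil k pf pt s hs =>
    intro pre post n hn
    set P := pre ++ ((Prog.loop k pf pt).code n ++ post) with hP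
    have hPl : P.length = n + (Prog.loop k pf pt).len + post.length := by
      simp [hP, Prog.length_code, hn]; omega
    simp only [Prog.len] at hPl
    have h0 : P[n]? = some (Line.branch k (n + 1 + pf.len + 1 + pt.len + 1) (n + 1)
        (n + 1 + pf.len + 1)) := by
      rw [hP, Prog.code]; exact getElem?_append_cons_of_eq _ _ _ hn
    have h1 := reaches_branch_nil (A := A) h0 (by omega) hs
    simp only [Prog.len]
    convert h1 using 1
    omega
  | @loop_cons k pf pt s s' s'' t t' b l hs h h' ih ih' =>
    intro pre post n hn
    have h6 := ih' pre post n hn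
    set P := pre ++ ((Prog.loop k pf pt).code n ++ post) with hP
    have hPl : P.length = n + (Prog.loop k pf pt).len + post.length := by
      simp [hP, Prog.length_code, hn]; omega
    simp only [Prog.len] at hPl
    have h0 : P[n]? = some (Line.branch k (n + 1 + pf.len + 1 + pt.len + 1) (n + 1)
        (n + 1 + pf.len + 1)) := by
      rw [hP, Prog.code]; exact getElem?_append_cons_of_eq _ _ _ hn
    have h1 := reaches_branch_cons (A := A) h0 (by omega) (by omega) hs
    cases b with
    | false =>
      set P₁ := pre ++ [Line.branch k (n + 1 + pf.len + 1 + pt.len + 1) (n + 1)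
        (n + 1 + pf.len + 1)] with hP₁
      set P₂ := Line.jump n :: (pt.code (n + 1 + pf.len + 1) ++ [Line.jump n] ++ post) with hP₂
      have hPe' : P = P₁ ++ (pf.code (n + 1) ++ P₂) := by
        simp [hP, hP₁, hP₂, Prog.code]
      have h2 := ih P₁ P₂ (n + 1) (by simp [hP₁, hn])
      simp only [Bool.false_eq_true, if_false] at h1 h2
      rw [← hPe'] at h2
      have h3 : P[n + 1 + pf.len]? = some (Line.jump n) := by
        rw [hPe', hP₂, ← List.append_assoc]
        exact getElem?_append_cons_of_eq _ _ _ (by simp [hP₁, hn, Prog.length_code]; try omega)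
      have h4 := reaches_jump (A := A) h3 (by omega) s'
      exact (((h1.trans h2).trans h4).trans h6).mono (by omega)
    | true =>
      set P₁ := pre ++ Line.branch k (n + 1 + pf.len + 1 + pt.len + 1) (n + 1)
        (n + 1 + pf.len + 1) :: (pf.code (n + 1) ++ [Line.jump n]) with hP₁
      have hPe' : P = P₁ ++ (pt.code (n + 1 + pf.len + 1) ++ Line.jump n :: post) := by
        simp [hP, hP₁, Prog.code]
      have h2 := ih P₁ (Line.jump n :: post) (n + 1 + pf.len + 1)
        (by simp [hP₁, hn, Prog.length_code]; omega)
      simp only [if_true] at h1 h2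
      rw [← hPe'] at h2
      have h3 : P[n + 1 + pf.len + 1 + pt.len]? = some (Line.jump n) := by
        rw [hPe', ← List.append_assoc]
        exact getElem?_append_cons_of_eq _ _ _ (by simp [hP₁, hn, Prog.length_code]; omega)
      have h4 := reaches_jump (A := A) h3 (by omega) s'
      exact (((h1.trans h2).trans h4).trans h6).mono (by omega)
  | @ask_yes p q s s' t hs h ih =>
    intro pre post n hn
    set P := pre ++ ((Prog.ask p q).code n ++ post) with hP
    have hPl : P.length = n + (Prog.ask p q).len + post.length := by
      simp [hP, Prog.length_code, hn]; omega
    simp only [Prog.len] at hPl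
    set l : Line := (1, fun _ => .query (n + 1) (n + 1 + p.len + 1)) with hl
    have h0 : P[n]? = some l := by
      rw [hP, Prog.code]; exact getElem?_append_cons_of_eq _ _ _ hn
    have h1 : Reaches A P n s (n + 1) s 1 := Reaches.of_step fun c hc => by
      obtain ⟨c', h1, h2, -⟩ := step_query (A := A) hc h0 (n₁ := n + 1) (n₂ := n + 1 + p.len + 1)
        (by omega) (by omega) (fun _ => rfl)
      exact ⟨c', h1, h2 hs⟩
    set P₁ := pre ++ [l] with hP₁
    set P₂ := Line.jump (n + 1 + p.len + 1 + q.len) :: q.code (n + 1 + p.len + 1) ++ post with hP₂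
    have hPe : P = P₁ ++ (p.code (n + 1) ++ P₂) := by
      simp [hP, hP₁, hP₂, Prog.code, hl]
    have h2 := ih P₁ P₂ (n + 1) (by simp [hP₁, hn])
    rw [← hPe] at h2
    have h3 : P[n + 1 + p.len]? = some (Line.jump (n + 1 + p.len + 1 + q.len)) := by
      rw [hPe, hP₂, ← List.append_assoc, List.cons_append]
      exact getElem?_append_cons_of_eq _ _ _ (by simp [hP₁, hn, Prog.length_code]; try omega)
    have h4 := reaches_jump (A := A) h3 (by omega) s'
    have h5 := (h1.trans h2).trans h4
    simp only [Prog.len]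
    convert h5.mono (t' := t + 2) (by omega) using 1
    omega
  | @ask_no p q s s' t hs h ih =>
    intro pre post n hn
    set P := pre ++ ((Prog.ask p q).code n ++ post) with hP
    have hPl : P.length = n + (Prog.ask p q).len + post.length := by
      simp [hP, Prog.length_code, hn]; omega
    simp only [Prog.len] at hPl
    set l : Line := (1, fun _ => .query (n + 1) (n + 1 + p.len + 1)) with hl
    have h0 : P[n]? = some l := by
      rw [hP, Prog.code]; exact getElem?_append_cons_of_eq _ _ _ hn
    have h1 : Reaches A P n s (n + 1 + p.len + 1) s 1 := Reaches.of_step fun c hc => by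
      obtain ⟨c', h1, -, h2⟩ := step_query (A := A) hc h0 (n₁ := n + 1) (n₂ := n + 1 + p.len + 1)
        (by omega) (by omega) (fun _ => rfl)
      exact ⟨c', h1, h2 hs⟩
    set P₁ := pre ++ l :: (p.code (n + 1) ++ [Line.jump (n + 1 + p.len + 1 + q.len)]) with hP₁
    have hPe : P = P₁ ++ (q.code (n + 1 + p.len + 1) ++ post) := by
      simp [hP, hP₁, Prog.code, hl]
    have h2 := ih P₁ post (n + 1 + p.len + 1) (by simp [hP₁, hn, Prog.length_code]; omega)
    rw [← hPe] at h2
    simp only [Prog.len]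
    convert (h1.trans h2).mono (t' := t + 2) (by omega) using 1
    omega

/-- Running a program as an oracle machine: the input is on stack `0`, the output on stack `2`. -/
theorem Exec.outputs {p : Prog} {x y : List Bool} {s' : Store} {t : ℕ}
    (h : Exec A p (fun k => if k = 0 then x else []) s' t) (hy : s' 2 = y) :
    (machine (p.code 0)).Outputs A x y t := by
  have h1 := h.reaches [] [] 0 rfl
  simp only [List.nil_append, List.append_nil, Nat.zero_add] at h1
  obtain ⟨m, hm, c, h2, h3, h4⟩ := h1 ((machine (p.code 0)).init x) (by
    refine ⟨rfl, fun k => ?_⟩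
    change TapeIs (if k = 0 then Turing.Tape.mk₁ (x.map Symbol.bit) else Turing.Tape.mk₁ []) _
    by_cases hk : k = 0
    · subst hk; exact TapeIs.mk₁ x
    · simp only [if_neg hk]; exact TapeIs.mk₁ [])
  refine ⟨m, hm, c, h2, ?_, ?_⟩
  · unfold OracleTM.step
    have : (machine (p.code 0)).instr c.state (c.tape ((machine (p.code 0)).scan c.state)).head
        = none := by
      simp only [machine] at h3 ⊢
      rw [h3, List.getElem?_eq_none (by rw [Prog.length_code])]
      rfl
    rw [this]
  · exact ((h4 2).holds_iff y).2 hy.symm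

/-! ### Programs on serialized binary trees -/

/-- Binary trees. -/
inductive Data where
  | nil : Data
  | cons (a b : Data) : Data

/-- The prefix-free serialization of a tree. -/
def Data.code : Data → List Bool
  | nil => [false]
  | cons a b => true :: (a.code ++ b.code)

/-- The store with the given stacks. -/
def st (a b c d : List Bool) : Store := ![a, b, c, d]

section st

variable (a b c d x : List Bool)

@[simp] theorem st_zero : st a b c d 0 = a := rfl
@[simp] theorem st_one : st a b c d 1 = b := rfl
@[simp] theorem st_two : st a b c d 2 = c := rfl
@[simp] theorem st_three : st a b c d 3 = d := rfl

@[simp] theorem update_st_zero : Function.update (st a b c d) 0 x = st x b c d := by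
  ext i : 1; fin_cases i <;> rfl

@[simp] theorem update_st_one : Function.update (st a b c d) 1 x = st a x c d := by
  ext i : 1; fin_cases i <;> rfl

@[simp] theorem update_st_two : Function.update (st a b c d) 2 x = st a b x d := by
  ext i : 1; fin_cases i <;> rfl

@[simp] theorem update_st_three : Function.update (st a b c d) 3 x = st a b c x := by
  ext i : 1; fin_cases i <;> rfl

end st

/-- The program `p` transforms `s` into `s'` in time at most `t`. -/
def Run (A : Language Bool) (p : Prog) (s s' : Store) (t : ℕ) : Prop := ∃ t' ≤ t, Exec A p s s' t'

infixr:60 " ;; " => Prog.seq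

namespace Run

theorem mono {p : Prog} {s s' : Store} {t t' : ℕ} (h : Run A p s s' t) (ht : t ≤ t') :
    Run A p s s' t' := by
  obtain ⟨u, hu, h⟩ := h
  exact ⟨u, hu.trans ht, h⟩

theorem nop (s : Store) (t : ℕ) : Run A .nop s s t := ⟨0, Nat.zero_le _, .nop s⟩

theorem seq {p q : Prog} {s s' s'' : Store} {t t' : ℕ} (h : Run A p s s' t)
    (h' : Run A q s' s'' t') : Run A (p ;; q) s s'' (t + t') := by
  obtain ⟨u, hu, h⟩ := h
  obtain ⟨u', hu', h'⟩ := h'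
  exact ⟨u + u', by omega, h.seq h'⟩

theorem push {k : Fin 4} {b : Bool} {s s' : Store} (h : Function.update s k (b :: s k) = s') :
    Run A (.push k b) s s' 2 := h ▸ ⟨2, le_rfl, .push k b s⟩

theorem pop {k : Fin 4} {pe pf pt : Prog} {s s' s'' : Store} {t : ℕ} {l : List Bool} (b : Bool)
    (hk : s k = b :: l) (hs : Function.update s k l = s')
    (h : Run A (if b then pt else pf) s' s'' t) : Run A (.pop k pe pf pt) s s'' (t + 2) := by
  obtain ⟨u, hu, h⟩ := h
  subst hs
  exact ⟨u + 2, by omega, .pop_cons hk h⟩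

theorem loop_nil {k : Fin 4} {pf pt : Prog} {s : Store} (hk : s k = []) :
    Run A (.loop k pf pt) s s 1 := ⟨1, le_rfl, .loop_nil hk⟩

theorem loop_cons {k : Fin 4} {pf pt : Prog} {s s' s'' s''' : Store} {t t' : ℕ} {l : List Bool}
    (b : Bool) (hk : s k = b :: l) (hs : Function.update s k l = s')
    (h : Run A (if b then pt else pf) s' s'' t) (h' : Run A (.loop k pf pt) s'' s''' t') :
    Run A (.loop k pf pt) s s''' (t + 2 + t') := by
  obtain ⟨u, hu, h⟩ := h
  obtain ⟨u', hu', h'⟩ := h'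
  subst hs
  exact ⟨u + 2 + u', by omega, .loop_cons hk h h'⟩

theorem ask_yes {p q : Prog} {s s' : Store} {t : ℕ} (hs : s 1 ∈ A) (h : Run A p s s' t) :
    Run A (.ask p q) s s' (t + 2) := by
  obtain ⟨u, hu, h⟩ := h
  exact ⟨u + 2, by omega, .ask_yes hs h⟩

theorem ask_no {p q : Prog} {s s' : Store} {t : ℕ} (hs : s 1 ∉ A) (h : Run A q s s' t) :
    Run A (.ask p q) s s' (t + 2) := by
  obtain ⟨u, hu, h⟩ := h
  exact ⟨u + 2, by omega, .ask_no hs h⟩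

end Run

/-! ### Basic programs and their running times -/

namespace Prog

/-- Move all the bits of stack `k` to stack `j`, reversing their order. -/
def move (k j : Fin 4) : Prog := .loop k (.push j false) (.push j true)

/-- Empty stack `k`. -/
def clear (k : Fin 4) : Prog := .loop k .nop .nop

/-- Move the topmost tree of stack `0` to stack `k`, reversing its bits. -/
def moveTree (k : Fin 4) : Prog :=
  -- Stack `3` counts in unary the trees still to be moved: a leaf settles one of them, an inner
  -- node replaces one by its two subtrees.
  .push 3 true ;; .loop 3 .nop (.pop 0 .nop (.push k false)
    (.push k true ;; .push 3 true ;; .push 3 true))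

/-- Remove the topmost tree. -/
def drop : Prog := moveTree 1 ;; clear 1

/-- Interchange the two topmost trees. -/
def swap : Prog := moveTree 1 ;; moveTree 2 ;; move 1 0 ;; move 2 0

/-- Duplicate the topmost tree. -/
def dup : Prog :=
  moveTree 1 ;; .loop 1 (.push 0 false ;; .push 2 false) (.push 0 true ;; .push 2 true) ;;
    move 2 1 ;; move 1 0

/-- Push a word on stack `0`. -/
def pushWord : List Bool → Prog
  | [] => .nop
  | b :: l => pushWord l ;; .push 0 b

/-- Remove a bit from stack `0`. -/
def skip : Prog := .pop 0 .nop .nop .nop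

end Prog

/-- The common pattern of loops that consume a stack bit by bit: `S x y` is the store when `x`
remains and `y` has been treated, most recent bit first. The treated bits therefore appear reversed.
-/
theorem run_loop {k : Fin 4} {pf pt : Prog} {t : ℕ} (S : List Bool → List Bool → Store)
    (hS : ∀ x y, S x y k = x)
    (h : ∀ b x y,
      Run A (if b then pt else pf) (Function.update (S (b :: x) y) k x) (S x (b :: y)) t)
    (x y : List Bool) :
    Run A (.loop k pf pt) (S x y) (S [] (x.reverse ++ y)) ((t + 2) * x.length + 1) := by
  induction x generalizing y with
  | nil => exact (Run.loop_nil (hS [] y)).mono (by simp)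
  | cons b x ih =>
    have := Run.loop_cons b (hS (b :: x) y) rfl (h b x y) (ih (b :: y))
    rw [List.reverse_cons, List.append_assoc, List.singleton_append]
    refine this.mono ?_
    rw [List.length_cons]
    ring_nf
    omega

theorem run_move_one_zero (x a c d : List Bool) :
    Run A (.move 1 0) (st a x c d) (st (x.reverse ++ a) [] c d) (4 * x.length + 1) := by
  have := run_loop (A := A) (k := 1) (pf := .push 0 false) (pt := .push 0 true) (t := 2)
    (fun x y => st (y ++ a) x c d) (fun _ _ => rfl)
    (by rintro (_ | _) x y <;> exact Run.push (by simp)) x []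
  simpa [Prog.move] using this

theorem run_move_two_zero (x a b d : List Bool) :
    Run A (.move 2 0) (st a b x d) (st (x.reverse ++ a) b [] d) (4 * x.length + 1) := by
  have := run_loop (A := A) (k := 2) (pf := .push 0 false) (pt := .push 0 true) (t := 2)
    (fun x y => st (y ++ a) b x d) (fun _ _ => rfl)
    (by rintro (_ | _) x y <;> exact Run.push (by simp)) x []
  simpa [Prog.move] using this

theorem run_move_zero_one (x b c d : List Bool) :
    Run A (.move 0 1) (st x b c d) (st [] (x.reverse ++ b) c d) (4 * x.length + 1) := by
  have := run_loop (A := A) (k := 0) (pf := .push 1 false) (pt := .push 1 true) (t := 2)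
    (fun x y => st x (y ++ b) c d) (fun _ _ => rfl)
    (by rintro (_ | _) x y <;> exact Run.push (by simp)) x []
  simpa [Prog.move] using this

theorem run_move_two_one (x a b d : List Bool) :
    Run A (.move 2 1) (st a b x d) (st a (x.reverse ++ b) [] d) (4 * x.length + 1) := by
  have := run_loop (A := A) (k := 2) (pf := .push 1 false) (pt := .push 1 true) (t := 2)
    (fun x y => st a (y ++ b) x d) (fun _ _ => rfl)
    (by rintro (_ | _) x y <;> exact Run.push (by simp)) x []
  simpa [Prog.move] using this

theorem run_move_one_three (x a c d : List Bool) :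
    Run A (.move 1 3) (st a x c d) (st a [] c (x.reverse ++ d)) (4 * x.length + 1) := by
  have := run_loop (A := A) (k := 1) (pf := .push 3 false) (pt := .push 3 true) (t := 2)
    (fun x y => st a x c (y ++ d)) (fun _ _ => rfl)
    (by rintro (_ | _) x y <;> exact Run.push (by simp)) x []
  simpa [Prog.move] using this

theorem run_move_three_two (x a b c : List Bool) :
    Run A (.move 3 2) (st a b c x) (st a b (x.reverse ++ c) []) (4 * x.length + 1) := by
  have := run_loop (A := A) (k := 3) (pf := .push 2 false) (pt := .push 2 true) (t := 2)
    (fun x y => st a b (y ++ c) x) (fun _ _ => rfl)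
    (by rintro (_ | _) x y <;> exact Run.push (by simp)) x []
  simpa [Prog.move] using this

theorem run_clear_one (x a c d : List Bool) :
    Run A (.clear 1) (st a x c d) (st a [] c d) (2 * x.length + 1) := by
  have := run_loop (A := A) (k := 1) (pf := .nop) (pt := .nop) (t := 0)
    (fun x _ => st a x c d) (fun _ _ => rfl)
    (by rintro (_ | _) x y <;> simpa using Run.nop _ _) x []
  simpa [Prog.clear] using this

theorem run_copy (x a c d : List Bool) :
    Run A (.loop 1 (.push 0 false ;; .push 2 false) (.push 0 true ;; .push 2 true)) (st a x c d)
      (st (x.reverse ++ a) [] (x.reverse ++ c) d) (6 * x.length + 1) := by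
  have := run_loop (A := A) (k := 1) (pf := .push 0 false ;; .push 2 false)
    (pt := .push 0 true ;; .push 2 true) (t := 4) (fun x y => st (y ++ a) x (y ++ c) d)
    (fun _ _ => rfl) (by
      rintro (_ | _) x y
      · exact (Run.push (s' := st (false :: (y ++ a)) x (y ++ c) d) (by simp)).seq
          (Run.push (by simp))
      · exact (Run.push (s' := st (true :: (y ++ a)) x (y ++ c) d) (by simp)).seq
          (Run.push (by simp))) x []
  simpa using this

theorem run_pushWord (x a b c d : List Bool) :
    Run A (.pushWord x) (st a b c d) (st (x ++ a) b c d) (2 * x.length) := by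
  induction x with
  | nil => exact Run.nop _ _
  | cons e x ih => exact (ih.seq (Run.push (by simp))).mono (by simp; omega)

theorem run_skip (e : Bool) (a b c d : List Bool) :
    Run A .skip (st (e :: a) b c d) (st a b c d) 2 :=
  Run.pop e rfl (update_st_zero ..) (by cases e <;> exact Run.nop _ _)

/-- The continuation form, in which a run of the remaining loop is extended by one more tree to be
moved, lets the induction treat the two subtrees of a node one after the other. -/
theorem run_moveTree_one_aux (x : Data) (r : List Bool) {b c d : List Bool} {s : Store} {t : ℕ}
    (h : Run A (.loop 3 .nop (.pop 0 .nop (.push 1 false)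
      (.push 1 true ;; .push 3 true ;; .push 3 true)))
      (st r (x.code.reverse ++ b) c d) s t) :
    Run A (.loop 3 .nop (.pop 0 .nop (.push 1 false)
      (.push 1 true ;; .push 3 true ;; .push 3 true)))
      (st (x.code ++ r) b c (true :: d)) s (10 * x.code.length + t) := by
  induction x generalizing r b d s t with
  | nil =>
    refine (Run.loop_cons true rfl (update_st_three ..) (Run.pop (t := 2) false rfl
      (update_st_zero ..) (Run.push (by simp [Data.code]))) h).mono ?_
    simp [Data.code]
  | cons x y ihx ihy =>
    have h1 := ihx (y.code ++ r) (ihy (b := x.code.reverse ++ true :: b) r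
      (by simpa [Data.code] using h))
    refine (Run.loop_cons true rfl (update_st_three ..) (Run.pop (t := 6) true rfl
      (update_st_zero ..) ?_)
      (s'' := st (x.code ++ (y.code ++ r)) (true :: b) c (true :: true :: d)) h1).mono ?_
    · exact (Run.push (s' := st (x.code ++ (y.code ++ r)) (true :: b) c d) (by simp)).seq
        ((Run.push (s' := st (x.code ++ (y.code ++ r)) (true :: b) c (true :: d)) (by simp)).seq
        (Run.push (by simp)))
    · simp [Data.code]; omega

theorem run_moveTree_one (x : Data) (r b c : List Bool) :
    Run A (.moveTree 1) (st (x.code ++ r) b c []) (st r (x.code.reverse ++ b) c [])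
      (10 * x.code.length + 3) :=
  ((Run.push (s' := st (x.code ++ r) b c [true]) (by simp)).seq
    (run_moveTree_one_aux x r (Run.loop_nil rfl))).mono (by omega)

theorem run_moveTree_two_aux (x : Data) (r : List Bool) {b c d : List Bool} {s : Store} {t : ℕ}
    (h : Run A (.loop 3 .nop (.pop 0 .nop (.push 2 false)
      (.push 2 true ;; .push 3 true ;; .push 3 true)))
      (st r b (x.code.reverse ++ c) d) s t) :
    Run A (.loop 3 .nop (.pop 0 .nop (.push 2 false)
      (.push 2 true ;; .push 3 true ;; .push 3 true)))
      (st (x.code ++ r) b c (true :: d)) s (10 * x.code.length + t) := by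
  induction x generalizing r c d s t with
  | nil =>
    refine (Run.loop_cons true rfl (update_st_three ..) (Run.pop (t := 2) false rfl
      (update_st_zero ..) (Run.push (by simp [Data.code]))) h).mono ?_
    simp [Data.code]
  | cons x y ihx ihy =>
    have h1 := ihx (y.code ++ r) (ihy (c := x.code.reverse ++ true :: c) r
      (by simpa [Data.code] using h))
    refine (Run.loop_cons true rfl (update_st_three ..) (Run.pop (t := 6) true rfl
      (update_st_zero ..) ?_)
      (s'' := st (x.code ++ (y.code ++ r)) b (true :: c) (true :: true :: d)) h1).mono ?_
    · exact (Run.push (s' := st (x.code ++ (y.code ++ r)) b (true :: c) d) (by simp)).seq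
        ((Run.push (s' := st (x.code ++ (y.code ++ r)) b (true :: c) (true :: d)) (by simp)).seq
        (Run.push (by simp)))
    · simp [Data.code]; omega

theorem run_moveTree_two (x : Data) (r b c : List Bool) :
    Run A (.moveTree 2) (st (x.code ++ r) b c []) (st r b (x.code.reverse ++ c) [])
      (10 * x.code.length + 3) :=
  ((Run.push (s' := st (x.code ++ r) b c [true]) (by simp)).seq
    (run_moveTree_two_aux x r (Run.loop_nil rfl))).mono (by omega)

theorem run_drop (x : Data) (r : List Bool) :
    Run A .drop (st (x.code ++ r) [] [] []) (st r [] [] []) (12 * x.code.length + 4) :=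
  ((run_moveTree_one x r [] []).seq (run_clear_one _ _ _ _)).mono (by simp; omega)

theorem run_swap (x y : Data) (r : List Bool) :
    Run A .swap (st (x.code ++ (y.code ++ r)) [] [] []) (st (y.code ++ (x.code ++ r)) [] [] [])
      (14 * x.code.length + 14 * y.code.length + 8) := by
  have h1 := run_moveTree_one (A := A) x (y.code ++ r) [] []
  have h2 := run_moveTree_two (A := A) y r (x.code.reverse ++ []) []
  have h3 := run_move_one_zero (A := A) (x.code.reverse ++ []) r (y.code.reverse ++ []) []
  have h4 := run_move_two_zero (A := A) (y.code.reverse ++ []) (x.code ++ r) [] []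
  simp only [List.append_nil, List.reverse_reverse, List.length_reverse] at *
  exact (h1.seq (h2.seq (h3.seq h4))).mono (by omega)

theorem run_dup (x : Data) (r : List Bool) :
    Run A .dup (st (x.code ++ r) [] [] []) (st (x.code ++ (x.code ++ r)) [] [] [])
      (24 * x.code.length + 6) := by
  have h1 := run_moveTree_one (A := A) x r [] []
  have h2 := run_copy (A := A) (x.code.reverse ++ []) r [] []
  have h3 := run_move_two_one (A := A) x.code (x.code ++ r) [] []
  have h4 := run_move_one_zero (A := A) (x.code.reverse ++ []) (x.code ++ r) [] []
  simp only [List.append_nil, List.reverse_reverse, List.length_reverse] at *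
  exact (h1.seq (h2.seq (h3.seq h4))).mono (by omega)

/-! ### Functions computable by programs in polynomial time -/

theorem eval_mono (p : Polynomial ℕ) {m n : ℕ} (h : m ≤ n) : p.eval m ≤ p.eval n := by
  rw [Polynomial.eval_eq_sum_range, Polynomial.eval_eq_sum_range]
  exact Finset.sum_le_sum fun i _ => Nat.mul_le_mul_left _ (Nat.pow_le_pow_left h i)

/-- Types whose elements are represented by trees. -/
class Enc (α : Type) where
  toData : α → Data

open Enc (toData)

instance : Enc Data := ⟨id⟩

instance {α β : Type} [Enc α] [Enc β] : Enc (α × β) := ⟨fun p => .cons (toData p.1) (toData p.2)⟩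

/-- Bits are represented by trees of the same size. -/
instance : Enc Bool :=
  ⟨fun b => if b then .cons (.cons .nil .nil) .nil else .cons .nil (.cons .nil .nil)⟩

/-- The tree that represents a list. -/
def listToData {α : Type} [Enc α] : List α → Data
  | [] => .nil
  | a :: l => .cons (toData a) (listToData l)

instance {α : Type} [Enc α] : Enc (List α) := ⟨listToData⟩

/-- The length of the code of an element. -/
def size {α : Type} [Enc α] (a : α) : ℕ := (toData a).code.length

section simps

variable {α β : Type} [Enc α] [Enc β]

@[simp] theorem toData_data (a : Data) : toData a = a := rfl
@[simp] theorem toData_pair (a : α) (b : β) : toData (a, b) = .cons (toData a) (toData b) := rfl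
@[simp] theorem toData_nil : toData ([] : List α) = .nil := rfl
@[simp] theorem toData_cons (a : α) (l : List α) :
    toData (a :: l) = .cons (toData a) (toData l) := rfl

@[simp] theorem size_dataNil : size Data.nil = 1 := rfl
@[simp] theorem size_dataCons (a b : Data) : size (Data.cons a b) = size a + size b + 1 := by
  simp [size, Data.code]
@[simp] theorem size_toData (a : α) : size (toData a) = size a := rfl
@[simp] theorem size_pair (a : α) (b : β) : size (a, b) = size a + size b + 1 :=
  size_dataCons (toData a) (toData b)
@[simp] theorem size_bool (b : Bool) : size b = 5 := by cases b <;> rfl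
@[simp] theorem size_nil : size ([] : List α) = 1 := rfl
@[simp] theorem size_cons (a : α) (l : List α) : size (a :: l) = size a + size l + 1 :=
  size_dataCons (toData a) (toData l)

theorem size_pos (a : α) : 0 < size a := by
  unfold size
  cases toData a <;> simp [Data.code]

theorem size_word (l : List Bool) : size l = 6 * l.length + 1 := by
  induction l with
  | nil => rfl
  | cons b l ih => simp [ih]; ring

theorem length_le_size (l : List α) : l.length ≤ size l := by
  induction l with
  | nil => simp
  | cons b l ih => simp; omega

end simps

/-- The functions computed by programs in polynomial time. -/
def FP (A : Language Bool) {α β : Type} [Enc α] [Enc β] (f : α → β) : Prop :=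
  ∃ (p : Prog) (T : Polynomial ℕ), ∀ a,
    -- The arbitrary rest `r` below the argument lets programs be used while other values are stored
    -- underneath. The bound on the size of the value is what makes compositions polynomial.
    (∀ r, Run A p (st ((toData a).code ++ r) [] [] []) (st ((toData (f a)).code ++ r) [] [] [])
      (T.eval (size a))) ∧ size (f a) ≤ T.eval (size a)

namespace FP

variable {A : Language Bool} {α β γ δ : Type} [Enc α] [Enc β] [Enc γ] [Enc δ]

theorem of_toData_eq {f : α → β} (h : ∀ a, toData (f a) = toData a) : FP A f :=
  ⟨.nop, .X, fun a => ⟨fun r => by rw [h]; exact Run.nop _ _, by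
    rw [size, h, Polynomial.eval_X]; rfl⟩⟩

theorem id : FP A (id : α → α) := of_toData_eq fun _ => rfl

theorem encode : FP A (toData : α → Data) := of_toData_eq fun _ => rfl

theorem size_le {f : α → β} (hf : FP A f) :
    ∃ T : Polynomial ℕ, ∀ a, size (f a) ≤ T.eval (size a) := by
  obtain ⟨p, T, h⟩ := hf
  exact ⟨T, fun a => (h a).2⟩

theorem congr {f : α → β} {g : α → γ} (hf : FP A f)
    (h : ∀ a, toData (g a) = toData (f a)) : FP A g := by
  obtain ⟨p, T, hp⟩ := hf
  refine ⟨p, T, fun a => ?_⟩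
  have := hp a
  rw [show size (f a) = size (g a) by rw [size, size, h], ← h a] at this
  exact this

theorem comp {g : β → γ} {f : α → β} (hg : FP A g) (hf : FP A f) : FP A fun a => g (f a) := by
  obtain ⟨p, T, hp⟩ := hf
  obtain ⟨q, U, hq⟩ := hg
  refine ⟨p ;; q, T + U.comp T, fun a => ⟨fun r => ?_, ?_⟩⟩
  · refine (((hp a).1 r).seq ((hq (f a)).1 r)).mono ?_
    rw [Polynomial.eval_add, Polynomial.eval_comp]
    exact Nat.add_le_add_left (eval_mono U (hp a).2) _
  · rw [Polynomial.eval_add, Polynomial.eval_comp]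
    exact ((hq (f a)).2.trans (eval_mono U (hp a).2)).trans (Nat.le_add_left _ _)

theorem pair {f : α → β} {g : α → γ} (hf : FP A f) (hg : FP A g) :
    FP A fun a => (f a, g a) := by
  obtain ⟨p, T, hp⟩ := hf
  obtain ⟨q, U, hq⟩ := hg
  refine ⟨.dup ;; q ;; .swap ;; p ;; .push 0 true,
    24 * .X + T + 15 * U + 14 * .X + T + 16, fun a => ⟨fun r => ?_, ?_⟩⟩
  · have h1 := run_dup (A := A) (toData a) r
    have h2 := (hq a).1 ((toData a).code ++ r)
    have h3 := run_swap (A := A) (toData (g a)) (toData a) r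
    have h4 := (hp a).1 ((toData (g a)).code ++ r)
    have h5 : Run A (.push 0 true)
      (st ((toData (f a)).code ++ ((toData (g a)).code ++ r)) [] [] [])
      (st ((toData (f a, g a)).code ++ r) [] [] []) 2 := Run.push (by simp [Data.code])
    refine (h1.seq (h2.seq (h3.seq (h4.seq h5)))).mono ?_
    have := (hq a).2
    simp only [Polynomial.eval_add, Polynomial.eval_mul, Polynomial.eval_ofNat,
      Polynomial.eval_X]
    simp only [size] at *
    omega
  · have := (hq a).2
    have := (hp a).2
    simp only [Polynomial.eval_add, Polynomial.eval_mul, Polynomial.eval_ofNat,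
      Polynomial.eval_X, size_pair]
    omega

theorem const (b : β) : FP A fun _ : α => b := by
  refine ⟨.drop ;; .pushWord (toData b).code, 12 * .X + 4 + .C (2 * size b),
    fun a => ⟨fun r => ?_, ?_⟩⟩
  · refine ((run_drop (toData a) r).seq (run_pushWord _ _ _ _ _)).mono ?_
    simp [size]
  · simp; omega

end FP

namespace Data

/-- The left subtree. -/
def car : Data → Data
  | nil => nil
  | cons a _ => a

/-- The right subtree. -/
def cdr : Data → Data
  | nil => nil
  | cons _ b => b

/-- Test for the empty tree. -/
def isNil : Data → Bool
  | nil => true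
  | cons _ _ => false

/-- The length of the right spine. -/
def spine : Data → ℕ
  | nil => 0
  | cons _ b => b.spine + 1

@[simp] theorem car_nil : nil.car = nil := rfl
@[simp] theorem car_cons (a b : Data) : (cons a b).car = a := rfl
@[simp] theorem cdr_nil : nil.cdr = nil := rfl
@[simp] theorem cdr_cons (a b : Data) : (cons a b).cdr = b := rfl
@[simp] theorem isNil_nil : nil.isNil = true := rfl
@[simp] theorem isNil_cons (a b : Data) : (cons a b).isNil = false := rfl

theorem size_car (a : Data) : size a.car ≤ size a := by cases a <;> simp [car]; omega

theorem size_cdr (a : Data) : size a.cdr ≤ size a := by cases a <;> simp [cdr]; omega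

theorem spine_le_size (a : Data) : a.spine ≤ size a := by
  induction a with
  | nil => simp [spine]
  | cons a b _ ih => simp [spine]; omega

@[simp] theorem spine_toData {α : Type} [Enc α] (l : List α) : (toData l).spine = l.length := by
  induction l with
  | nil => rfl
  | cons a l ih => simp [spine, ih]

end Data

/-! ### Subtrees, branching and iteration -/

namespace FP

variable {A : Language Bool} {α β γ δ : Type} [Enc α] [Enc β] [Enc γ] [Enc δ]

theorem car : FP A Data.car := by
  refine ⟨.pop 0 .nop (.push 0 false) (.moveTree 1 ;; .moveTree 2 ;; .move 1 0 ;; .move 2 1 ;;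
    .clear 1), 30 * .X + 20, fun a => ⟨fun r => ?_, ?_⟩⟩
  · cases a with
    | nil =>
      exact (Run.pop false rfl (update_st_zero ..) (Run.push (s' := st ((toData Data.nil).code ++ r)
        [] [] []) (by simp [Data.code]))).mono (by simp)
    | cons x y =>
      have h1 := run_moveTree_one (A := A) x (y.code ++ r) [] []
      have h2 := run_moveTree_two (A := A) y r (x.code.reverse ++ []) []
      have h3 := run_move_one_zero (A := A) (x.code.reverse ++ []) r (y.code.reverse ++ []) []
      have h4 := run_move_two_one (A := A) (y.code.reverse ++ []) (x.code ++ r) [] []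
      have h5 := run_clear_one (A := A) y.code (x.code ++ r) [] []
      simp only [List.append_nil, List.reverse_reverse, List.length_reverse] at *
      refine (Run.pop true ?_ (update_st_zero ..) (h1.seq (h2.seq (h3.seq (h4.seq h5))))).mono ?_
      · simp [Data.code]
      · simp [size, Data.code]; omega
  · have := a.size_car
    simp
    omega

theorem cdr : FP A Data.cdr := by
  refine ⟨.pop 0 .nop (.push 0 false) .drop, 12 * .X + 6, fun a => ⟨fun r => ?_, ?_⟩⟩
  · cases a with
    | nil =>
      exact (Run.pop false rfl (update_st_zero ..) (Run.push (s' := st ((toData Data.nil).code ++ r)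
        [] [] []) (by simp [Data.code]))).mono (by simp)
    | cons x y =>
      have h1 := run_drop (A := A) x (y.code ++ r)
      refine (Run.pop true ?_ (update_st_zero ..) h1).mono ?_
      · simp [Data.code]
      · simp [size, Data.code]; omega
  · have := a.size_cdr
    simp
    omega

theorem fst : FP A (Prod.fst : α × β → α) :=
  (car.comp encode).congr fun _ => rfl

theorem snd : FP A (Prod.snd : α × β → β) :=
  (cdr.comp encode).congr fun _ => rfl

theorem ite_isNil {c : α → Data} {f g : α → β} (hc : FP A c) (hf : FP A f) (hg : FP A g) :
    FP A fun a => if (c a).isNil then f a else g a := by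
  obtain ⟨p, T, hp⟩ := hf
  obtain ⟨q, U, hq⟩ := hg
  obtain ⟨pc, V, hc⟩ := hc
  refine ⟨.dup ;; pc ;; .pop 0 .nop p (.drop ;; .drop ;; q), 24 * .X + 13 * V + T + U + 30,
    fun a => ⟨fun r => ?_, ?_⟩⟩
  · have h1 := run_dup (A := A) (toData a) r
    have h2 := (hc a).1 ((toData a).code ++ r)
    have h3 := (hp a).1 r
    have h4 := (hq a).1 r
    have h5 := (hc a).2
    simp only
    cases h : c a with
    | nil =>
      rw [h] at h2 h5
      refine (h1.seq (h2.seq (Run.pop false rfl (update_st_zero ..) h3))).mono ?_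
      simp only [Polynomial.eval_add, Polynomial.eval_mul, Polynomial.eval_ofNat,
        Polynomial.eval_X]
      simp only [size] at *
      omega
    | cons x y =>
      rw [h] at h2 h5
      have h6 := run_drop (A := A) x (y.code ++ ((toData a).code ++ r))
      have h7 := run_drop (A := A) y ((toData a).code ++ r)
      refine (h1.seq (h2.seq (Run.pop true ?_ (update_st_zero ..) (h6.seq (h7.seq h4))))).mono ?_
      · simp [Data.code]
      · simp only [Polynomial.eval_add, Polynomial.eval_mul, Polynomial.eval_ofNat,
          Polynomial.eval_X]
        simp only [size, toData_data, Data.code, List.length_cons, List.length_append] at *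
        omega
  · have := (hq a).2
    have := (hp a).2
    simp only [Polynomial.eval_add, Polynomial.eval_mul, Polynomial.eval_ofNat,
      Polynomial.eval_X]
    split <;> omega

theorem cond {c : α → Bool} {f g : α → β} (hc : FP A c) (hf : FP A f) (hg : FP A g) :
    FP A fun a => if c a then f a else g a :=
  (ite_isNil (car.comp (encode.comp hc)) hg hf).congr fun a => by
    cases h : c a <;> simp [toData, Data.car, Data.isNil]

/-- The program that iterates `p`. -/
def iterProg (p : Prog) : Prog :=
  .skip ;; .push 3 true ;; .loop 3 .nop (.pop 0 .nop .nop (.drop ;; .swap ;; p ;; .swap ;;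
    .push 3 true))

/-- Stack `3` holds one flag that keeps the loop alive. Each round removes a cell of the spine of
the counter `n`, applies `p` to the value below it and renews the flag; when `n` is a leaf, the flag
is not renewed. -/
theorem run_iter {f : α → α} {p : Prog} {B T : ℕ} (n : Data) (a : α) (r : List Bool)
    (hp : ∀ a, size a ≤ B → ∀ r, Run A p (st ((toData a).code ++ r) [] [] [])
      (st ((toData (f a)).code ++ r) [] [] []) T)
    (hB : ∀ i ≤ n.spine, size (f^[i] a) ≤ B) :
    Run A (.loop 3 .nop (.pop 0 .nop .nop (.drop ;; .swap ;; p ;; .swap ;; .push 3 true)))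
      (st (n.code ++ ((toData a).code ++ r)) [] [] [true])
      (st ((toData (f^[n.spine] a)).code ++ r) [] [] [])
      ((n.spine + 1) * (40 * size n + 28 * B + T + 30)) := by
  induction n generalizing a with
  | nil =>
    refine (Run.loop_cons true rfl (update_st_three ..) (Run.pop false rfl (update_st_zero ..)
      (Run.nop _ 0)) (Run.loop_nil rfl)).mono ?_
    simp [Data.spine]
  | cons x n _ ih =>
    have h0 := ih (f a) fun i hi => hB (i + 1) (by simpa [Data.spine] using hi)
    have h1 := run_drop (A := A) x (n.code ++ ((toData a).code ++ r))
    have h2 := run_swap (A := A) n (toData a) r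
    have h3 := hp a (hB 0 (Nat.zero_le _)) (n.code ++ r)
    have h4 := run_swap (A := A) (toData (f a)) n r
    have h5 : Run A (.push 3 true) (st (n.code ++ ((toData (f a)).code ++ r)) [] [] [])
      (st (n.code ++ ((toData (f a)).code ++ r)) [] [] [true]) 2 := Run.push (by simp)
    have h6 : size a ≤ B := hB 0 (Nat.zero_le _)
    have h7 : size (f a) ≤ B := hB 1 (by simp [Data.spine])
    refine (Run.loop_cons true rfl (update_st_three ..) (Run.pop true ?_ (update_st_zero ..)
      (h1.seq (h2.seq (h3.seq (h4.seq h5))))) h0).mono ?_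
    · simp [Data.code]
    · simp only [size_dataCons, Data.spine]
      have h8 : (n.spine + 1) * (40 * size n + 28 * B + T + 30) ≤
          (n.spine + 1) * (40 * (size x + size n + 1) + 28 * B + T + 30) :=
        Nat.mul_le_mul_left _ (by omega)
      rw [Nat.add_mul (n.spine + 1), Nat.one_mul]
      simp only [size, toData_data] at *
      omega

/-- Iterating a polynomial-time function may make its values grow exponentially, hence the
polynomial bound `B` on all intermediate values. The counter is a tree, read in unary through its
spine. -/
theorem iterate {f : β → β} {n : α → Data} {a : α → β} (hf : FP A f) (hn : FP A n) (ha : FP A a)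
    (B : Polynomial ℕ) (hB : ∀ x, ∀ i ≤ (n x).spine, size (f^[i] (a x)) ≤ B.eval (size x)) :
    FP A fun x => f^[(n x).spine] (a x) := by
  obtain ⟨p, T, hp⟩ := hf
  obtain ⟨q, U, hq⟩ := hn.pair ha
  refine ⟨q ;; iterProg p,
    U + (U + 1) * (40 * U + 28 * B + T.comp B + 30) + B + 10, fun x => ⟨fun r => ?_, ?_⟩⟩
  · have h1 := (hq x).1 r
    have h2 := run_iter (A := A) (n x) (a x) r (B := B.eval (size x)) (T := T.eval (B.eval (size x)))
      (fun b hb r => ((hp b).1 r).mono (eval_mono T hb)) (hB x)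
    have h3 : Run A (.push 3 true) (st ((n x).code ++ ((toData (a x)).code ++ r)) [] [] [])
      (st ((n x).code ++ ((toData (a x)).code ++ r)) [] [] [true]) 2 := Run.push (by simp)
    have h4 := run_skip (A := A) true ((n x).code ++ ((toData (a x)).code ++ r)) [] [] []
    have h5 : (toData (n x, a x)).code ++ r =
      true :: ((n x).code ++ ((toData (a x)).code ++ r)) := by simp [Data.code]
    rw [h5] at h1
    refine (h1.seq (h4.seq (h3.seq h2))).mono ?_
    have h6 := (hq x).2
    rw [size_pair] at h6
    have h7 := (n x).spine_le_size
    simp only [Polynomial.eval_add, Polynomial.eval_mul, Polynomial.eval_ofNat,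
      Polynomial.eval_one, Polynomial.eval_comp]
    have h8 : ((n x).spine + 1) * (40 * size (n x) + 28 * B.eval (size x) +
        T.eval (B.eval (size x)) + 30) ≤ (U.eval (size x) + 1) * (40 * U.eval (size x) +
        28 * B.eval (size x) + T.eval (B.eval (size x)) + 30) :=
      Nat.mul_le_mul (by omega) (by omega)
    omega
  · simp only [Polynomial.eval_add]
    have := hB x _ le_rfl
    omega

end FP

namespace Prog

/-- Pop a list of bits from stack `0` and push the bits on stack `2`. -/
def readWord : Prog :=
  .push 3 true ;; .loop 3 .nop (.pop 0 .nop .nop (.skip ;; .pop 0 .nop (.push 2 false)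
    (.push 2 true) ;; .skip ;; .skip ;; .skip ;; .push 3 true))

end Prog

/-! ### Words, oracle tests and the passage to machines -/

section words

variable {A : Language Bool}

theorem run_readWord (w r c : List Bool) :
    Run A .readWord (st ((toData w).code ++ r) [] c []) (st r [] (w.reverse ++ c) [])
      (20 * w.length + 10) := by
  have key : Run A (.loop 3 .nop (.pop 0 .nop .nop (.skip ;; .pop 0 .nop (.push 2 false)
    (.push 2 true) ;; .skip ;; .skip ;; .skip ;; .push 3 true)))
      (st ((toData w).code ++ r) [] c [true]) (st r [] (w.reverse ++ c) [])
      (20 * w.length + 8) := by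
    induction w generalizing c with
    | nil =>
      exact (Run.loop_cons true rfl (update_st_three ..) (Run.pop false rfl (update_st_zero ..)
        (Run.nop _ 0)) (Run.loop_nil rfl)).mono (by simp)
    | cons b w ih =>
      set m := (toData w).code ++ r with hm
      -- The first bit marks a list cell; the other five encode `b`, the second of them being `b`
      -- itself.
      have h0 : (toData (b :: w)).code ++ r = true :: true :: b :: (!b) :: false :: false :: m := by
        cases b <;> simp [Data.code, toData, hm, listToData]
      have h1 := run_skip (A := A) true (b :: (!b) :: false :: false :: m) [] c []
      have h2 : Run A (.pop 0 .nop (.push 2 false) (.push 2 true))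
          (st (b :: (!b) :: false :: false :: m) [] c [])
          (st ((!b) :: false :: false :: m) [] (b :: c) []) 4 :=
        Run.pop b rfl (update_st_zero ..) (by cases b <;> exact Run.push (by simp))
      have h3 := run_skip (A := A) (!b) (false :: false :: m) [] (b :: c) []
      have h4 := run_skip (A := A) false (false :: m) [] (b :: c) []
      have h5 := run_skip (A := A) false m [] (b :: c) []
      have h6 : Run A (.push 3 true) (st m [] (b :: c) []) (st m [] (b :: c) [true]) 2 :=
        Run.push (by simp)
      rw [h0]
      have := Run.loop_cons true rfl (update_st_three ..) (Run.pop true rfl (update_st_zero ..)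
        (h1.seq (h2.seq (h3.seq (h4.seq (h5.seq h6)))))) (ih (b :: c))
      simp only [List.reverse_cons, List.append_assoc, List.singleton_append]
      exact this.mono (by simp; omega)
  exact ((Run.push (s' := st ((toData w).code ++ r) [] c [true]) (by simp)).seq key).mono (by omega)

-- Reading the list leaves the word reversed on stack `2`; moving it to the query stack restores the
-- order.
open Classical in
theorem FP.mem_oracle : FP A fun w : List Bool => decide (w ∈ A) := by
  refine ⟨.readWord ;; .move 2 1 ;; .ask (.clear 1 ;; .pushWord (toData true).code)
    (.clear 1 ;; .pushWord (toData false).code), 30 * .X + 40, fun w => ⟨fun r => ?_, ?_⟩⟩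
  · have h1 := run_readWord (A := A) w r []
    have h2 := run_move_two_one (A := A) (w.reverse ++ []) r [] []
    have h3 := run_clear_one (A := A) w r [] []
    have h4 := fun x => run_pushWord (A := A) x r [] [] []
    simp only [List.append_nil, List.reverse_reverse, List.length_reverse] at *
    have h5 := length_le_size w
    by_cases hw : w ∈ A
    · refine (h1.seq (h2.seq (Run.ask_yes hw (h3.seq (h4 _))))).mono ?_ |> fun h => by
        simpa [hw] using h
      have : (toData true).code.length = 5 := size_bool true
      simp [this]
      omega
    · refine (h1.seq (h2.seq (Run.ask_no hw (h3.seq (h4 _))))).mono ?_ |> fun h => by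
        simpa [hw] using h
      have : (toData false).code.length = 5 := size_bool false
      simp [this]
      omega
  · simp

/-- For `n ≥ 1` the value is at most `p(1) * n ^ deg p`, and for `n ≥ 2` the factor `p(1)` is at
most `n ^ p(1)`. The additive `j` covers `n < 2`. -/
theorem exists_pow_bound (p : Polynomial ℕ) : ∃ j, ∀ n, p.eval n ≤ n ^ j + j := by
  have key : ∀ n, 1 ≤ n → p.eval n ≤ p.eval 1 * n ^ p.natDegree := by
    intro n hn
    rw [Polynomial.eval_eq_sum_range, Polynomial.eval_eq_sum_range, Finset.sum_mul]
    refine Finset.sum_le_sum fun i hi => ?_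
    rw [one_pow, mul_one]
    exact Nat.mul_le_mul_left _ (Nat.pow_le_pow_right hn (by simpa [Nat.lt_succ_iff] using hi))
  refine ⟨p.eval 1 + p.natDegree, fun n => ?_⟩
  rcases Nat.lt_or_ge n 2 with hn | hn
  · have := eval_mono p (show n ≤ 1 by omega)
    omega
  · refine ((key n (by omega)).trans ?_).trans (Nat.le_add_right _ _)
    rw [pow_add]
    exact Nat.mul_le_mul_right _ ((Nat.lt_two_pow_self).le.trans (Nat.pow_le_pow_left hn _))

theorem FP.exists_machine {f : List Bool → List Bool} (hf : FP A f) :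
    ∃ (M : OracleTM) (j : ℕ), ∀ x, M.Outputs A x (f x) (x.length ^ j + j) := by
  obtain ⟨p, T, hp⟩ := hf
  set conv : Prog := .loop 1 (.pushWord (true :: (toData false).code))
    (.pushWord (true :: (toData true).code)) with hconv
  obtain ⟨j, hj⟩ := exists_pow_bound
    (4 * .X + 1 + 2 + (14 * .X + 1) + T.comp (6 * .X + 1) + (20 * T.comp (6 * .X + 1) + 10) +
      3 * (4 * T.comp (6 * .X + 1) + 1))
  -- `readWord` leaves the output reversed on stack `2`. Three moves, hence an odd number of
  -- reversals, bring it back there in the right order.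
  refine ⟨machine ((.move 0 1 ;; .push 0 false ;; conv ;; p ;; .readWord ;; .move 2 1 ;;
    .move 1 3 ;; .move 3 2 : Prog).code 0), j, fun x => ?_⟩
  have h1 := run_move_zero_one (A := A) x [] [] []
  have h2 : Run A (.push 0 false) (st [] x.reverse [] []) (st [false] x.reverse [] []) 2 :=
    Run.push (by simp)
  have h3 := run_loop (A := A) (k := 1) (pf := .pushWord (true :: (toData false).code))
    (pt := .pushWord (true :: (toData true).code)) (t := 12)
    (fun x y => st (toData y).code x [] []) (fun _ _ => rfl)
    (by
      rintro (_ | _) x y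
      · have h := run_pushWord (A := A) (true :: (toData false).code) (toData y).code x [] []
        rw [update_st_one, if_neg (by simp)]
        exact (h.mono (t' := 12) (by rfl)) |> fun h => by simpa [Data.code] using h
      · have h := run_pushWord (A := A) (true :: (toData true).code) (toData y).code x [] []
        rw [update_st_one, if_pos rfl]
        exact (h.mono (t' := 12) (by rfl)) |> fun h => by simpa [Data.code] using h) x.reverse []
  have h4 := (hp x).1 []
  have h5 := run_readWord (A := A) (f x) [] []
  have h6 := run_move_two_one (A := A) (f x).reverse [] [] []
  have h7 := run_move_one_three (A := A) (f x) [] [] []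
  have h8 := run_move_three_two (A := A) (f x).reverse [] [] []
  simp only [List.append_nil, List.reverse_reverse, List.length_reverse] at *
  obtain ⟨t, ht, h⟩ := h1.seq (h2.seq (h3.seq (h4.seq (h5.seq (h6.seq (h7.seq h8))))))
  have hin : st x [] [] [] = fun k => if k = 0 then x else [] := by
    ext k : 1; fin_cases k <;> rfl
  rw [hin] at h
  obtain ⟨m, hm, hout⟩ := h.outputs (y := f x) rfl
  refine ⟨m, (hm.trans ht).trans (le_trans ?_ (hj x.length)), hout⟩
  have h9 := (hp x).2
  have h10 := length_le_size (f x)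
  have h11 := size_word x
  simp only [Polynomial.eval_add, Polynomial.eval_mul, Polynomial.eval_ofNat,
      Polynomial.eval_one, Polynomial.eval_comp, Polynomial.eval_X]
  rw [h11] at h9 ⊢
  omega

end words

/-! ### Derived closure properties -/

instance : Inhabited Data := ⟨.nil⟩

namespace FP

variable {A : Language Bool} {α β γ δ : Type} [Enc α] [Enc β] [Enc γ] [Enc δ]

theorem cons {f : α → β} {g : α → List β} (hf : FP A f) (hg : FP A g) :
    FP A fun x => f x :: g x :=
  (hf.pair hg).congr fun _ => rfl

theorem dataCons {f g : α → Data} (hf : FP A f) (hg : FP A g) :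
    FP A fun x => Data.cons (f x) (g x) :=
  (hf.pair hg).congr fun _ => rfl

theorem headI [Inhabited β] : FP A (List.headI : List β → β) :=
  (ite_isNil encode (const (toData (default : β))) (car.comp encode)).congr fun l => by
    cases l <;> simp [Data.isNil, Data.car]

theorem tail : FP A (List.tail : List β → List β) :=
  (cdr.comp encode).congr fun l => by cases l <;> simp [Data.cdr]

theorem ite_nil {l : α → List β} {f g : α → γ} (hl : FP A l) (hf : FP A f) (hg : FP A g) :
    FP A fun x => if (l x).isEmpty then f x else g x :=
  (ite_isNil (encode.comp hl) hf hg).congr fun x => by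
    cases h : l x <;> simp [Data.isNil]

/-- Iteration of a function with a parameter, with a bound on the intermediate results. -/
theorem iterate_param {g : α × γ → γ} {n : α → Data} {c : α → γ} (hg : FP A g) (hn : FP A n)
    (hc : FP A c) (B : Polynomial ℕ)
    (hB : ∀ x, ∀ i ≤ (n x).spine, size ((fun y => g (x, y))^[i] (c x)) ≤ B.eval (size x)) :
    FP A fun x => (fun y => g (x, y))^[(n x).spine] (c x) := by
  have key : ∀ x i, (fun s : α × γ => (s.1, g s))^[i] (x, c x) =
      (x, (fun y => g (x, y))^[i] (c x)) := by
    intro x i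
    induction i with
    | zero => rfl
    | succ i ih => rw [Function.iterate_succ_apply', ih, Function.iterate_succ_apply']
  refine (snd.comp (iterate (f := fun s : α × γ => (s.1, g s)) (fst.pair hg) hn (id.pair hc)
    (.X + B + 1) fun x i hi => ?_)).congr fun x => ?_
  · rw [id_eq, key, size_pair]
    have := hB x i hi
    simp
    omega
  · simp [key]

/-- If each step adds at most a polynomial in the size of the parameter, then polynomially many
steps keep the values polynomial. -/
theorem iterate_add {g : α × γ → γ} {n : α → Data} {c : α → γ} (hg : FP A g) (hn : FP A n)
    (hc : FP A c) (B : Polynomial ℕ) (hB : ∀ x y, size (g (x, y)) ≤ size y + B.eval (size x)) :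
    FP A fun x => (fun y => g (x, y))^[(n x).spine] (c x) := by
  obtain ⟨T, hT⟩ := hc.size_le
  obtain ⟨U, hU⟩ := hn.size_le
  have key : ∀ x i, size ((fun y => g (x, y))^[i] (c x)) ≤ size (c x) + i * B.eval (size x) := by
    intro x i
    induction i with
    | zero => simp
    | succ i ih =>
      rw [Function.iterate_succ_apply', Nat.succ_mul]
      have := hB x ((fun y => g (x, y))^[i] (c x))
      omega
  refine iterate_param hg hn hc (T + U * B) fun x i hi => ?_
  have h1 := hT x
  have h2 := key x i
  have h3 : i * B.eval (size x) ≤ U.eval (size x) * B.eval (size x) :=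
    Nat.mul_le_mul_right _ ((hi.trans (n x).spine_le_size).trans (hU x))
  simp only [Polynomial.eval_add, Polynomial.eval_mul]
  omega

/-- The fold is an iteration on the pair of accumulator and remaining list, with the list itself as
the unary counter. -/
theorem foldl [Inhabited β] {g : α × γ × β → γ} {l : α → List β} {c : α → γ} (hg : FP A g)
    (hl : FP A l) (hc : FP A c) (B : Polynomial ℕ)
    (hB : ∀ x i, size (((l x).take i).foldl (fun y b => g (x, y, b)) (c x)) ≤ B.eval (size x)) :
    FP A fun x => (l x).foldl (fun y b => g (x, y, b)) (c x) := by
  obtain ⟨U, hU⟩ := hl.size_le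
  set F : α × γ × List β → γ × List β :=
    fun s => if s.2.2.isEmpty then s.2 else (g (s.1, s.2.1, s.2.2.headI), s.2.2.tail) with hF
  have hFP : FP A F := ite_nil (snd.comp snd) snd ((hg.comp (fst.pair ((fst.comp snd).pair
    (headI.comp (snd.comp snd))))).pair (tail.comp (snd.comp snd)))
  have key : ∀ x i, (fun y => F (x, y))^[i] (c x, l x) =
      (((l x).take i).foldl (fun y b => g (x, y, b)) (c x), (l x).drop i) := by
    intro x i
    induction i with
    | zero => simp
    | succ i ih =>
      rw [Function.iterate_succ_apply', ih]
      rcases h : (l x).drop i with _ | ⟨b, t⟩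
      · have hi := List.drop_eq_nil_iff.1 h
        rw [List.drop_eq_nil_of_le (by omega), List.take_of_length_le hi,
          List.take_of_length_le (by omega)]
        simp [hF]
      · have hi : i < (l x).length := by
          by_contra hi
          rw [List.drop_eq_nil_of_le (by omega)] at h
          cases h
        rw [List.drop_eq_getElem_cons hi] at h
        simp only [List.cons.injEq] at h
        rw [List.take_add_one, List.foldl_append, List.getElem?_eq_getElem hi, h.1, h.2]
        simp [hF]
  have hdrop : ∀ (l : List β) i, size (l.drop i) ≤ size l := by
    intro l
    induction l with
    | nil => simp
    | cons b l ih =>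
      intro i
      cases i with
      | zero => simp
      | succ i => have := ih i; simp; omega
  refine (fst.comp (iterate_param hFP (encode.comp hl) (hc.pair hl) (B + U + 1)
    fun x i _ => ?_)).congr fun x => ?_
  · rw [key, size_pair]
    have h1 := hB x i
    have h2 := hdrop (l x) i
    have h3 := hU x
    simp
    omega
  · rw [key]
    simp

theorem foldl_add [Inhabited β] {g : α × γ × β → γ} {l : α → List β} {c : α → γ} (hg : FP A g)
    (hl : FP A l) (hc : FP A c) (B : Polynomial ℕ)
    (hB : ∀ x y, ∀ b ∈ l x, size (g (x, y, b)) ≤ size y + B.eval (size x)) :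
    FP A fun x => (l x).foldl (fun y b => g (x, y, b)) (c x) := by
  obtain ⟨T, hT⟩ := hc.size_le
  obtain ⟨U, hU⟩ := hl.size_le
  have key : ∀ x (l' : List β) y, (∀ b ∈ l', b ∈ l x) →
      size (l'.foldl (fun y b => g (x, y, b)) y) ≤ size y + l'.length * B.eval (size x) := by
    intro x l'
    induction l' with
    | nil => simp
    | cons b l' ih =>
      intro y hb
      have h1 := ih (g (x, y, b)) fun b' h' => hb b' (List.mem_cons_of_mem _ h')
      have h2 := hB x y b (hb b List.mem_cons_self)
      rw [List.foldl_cons, List.length_cons, Nat.succ_mul]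
      omega
  refine foldl hg hl hc (T + U * B) fun x i => ?_
  have h1 := hT x
  have h2 := key x ((l x).take i) (c x) fun b hb => List.mem_of_mem_take hb
  have h3 : ((l x).take i).length * B.eval (size x) ≤ U.eval (size x) * B.eval (size x) := by
    refine Nat.mul_le_mul_right _ (le_trans ?_ ((length_le_size _).trans (hU x)))
    simp
  simp only [Polynomial.eval_add, Polynomial.eval_mul]
  omega

theorem size_le_of_mem {b : β} {l : List β} (h : b ∈ l) : size b ≤ size l := by
  induction l with
  | nil => cases h
  | cons a l ih =>
    rw [size_cons]
    rcases List.mem_cons.1 h with rfl | h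
    · omega
    · have := ih h
      omega

theorem reverse [Inhabited β] : FP A (List.reverse : List β → List β) := by
  refine (foldl_add (α := List β) (γ := List β) (g := fun s => s.2.2 :: s.2.1) (l := _root_.id)
    (c := fun _ => []) (cons (snd.comp snd) (fst.comp snd)) id (const _) (.X + 1)
    fun x y b hb => ?_).congr fun x => ?_
  · have := size_le_of_mem hb
    simp at this ⊢
    omega
  · have : ∀ l r : List β, l.foldl (fun y b => b :: y) r = l.reverse ++ r := by
      intro l
      induction l with
      | nil => simp
      | cons b l ih => intro r; simp [ih]
    simp [this]

theorem append [Inhabited β] {f g : α → List β} (hf : FP A f) (hg : FP A g) :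
    FP A fun x => f x ++ g x := by
  obtain ⟨T, hT⟩ := (reverse.comp hf).size_le
  refine (foldl_add (γ := List β) (g := fun s : α × List β × β => s.2.2 :: s.2.1)
    (l := fun x => (f x).reverse)
    (c := g) (cons (snd.comp snd) (fst.comp snd)) (reverse.comp hf) hg (T + 1)
    fun x y b hb => ?_).congr fun x => ?_
  · have := size_le_of_mem hb
    have := hT x
    simp at this ⊢
    omega
  · simp

theorem map [Inhabited β] [Inhabited γ] {g : α × β → γ} {l : α → List β} (hg : FP A g)
    (hl : FP A l) : FP A fun x => (l x).map fun b => g (x, b) := by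
  obtain ⟨T, hT⟩ := hg.size_le
  obtain ⟨U, hU⟩ := hl.size_le
  refine (reverse.comp (foldl_add (γ := List γ) (l := l)
    (g := fun s : α × List γ × β => g (s.1, s.2.2) :: s.2.1)
    (c := fun _ => []) (cons (hg.comp (fst.pair (snd.comp snd))) (fst.comp snd)) hl (const _)
    (T.comp (.X + U + 1) + 1) fun x y b hb => ?_)).congr fun x => ?_
  · have h1 := size_le_of_mem hb
    have h2 := hT (x, b)
    have h3 := hU x
    have h4 := eval_mono T (m := size (x, b)) (n := size x + U.eval (size x) + 1)
      (by rw [size_pair]; omega)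
    simp at h2 h4 ⊢
    omega
  · have : ∀ (l : List β) r, l.foldl (fun y b => g (x, b) :: y) r =
        (l.map fun b => g (x, b)).reverse ++ r := by
      intro l
      induction l with
      | nil => simp
      | cons b l ih => intro r; simp [ih]
    simp [this]

end FP

/-! ### A universal simulation -/

namespace Data

/-- The entry of index `n` of a list. -/
def nth (l : Data) (n : ℕ) : Data := (cdr^[n] l).car

/-- Replace the entry of index `n` of a list. -/
def set : Data → ℕ → Data → Data
  | l, 0, v => cons v l.cdr
  | l, n + 1, v => cons l.car (set l.cdr n v)

/-- Numerals. -/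
def num : ℕ → Data
  | 0 => nil
  | n + 1 => cons nil (num n)

@[simp] theorem spine_num (n : ℕ) : (num n).spine = n := by
  induction n with
  | zero => rfl
  | succ n ih => simp [num, spine, ih]

@[simp] theorem nth_zero (l : Data) : l.nth 0 = l.car := rfl

theorem nth_succ (l : Data) (n : ℕ) : l.nth (n + 1) = l.cdr.nth n := rfl

@[simp] theorem nth_cons_succ (a l : Data) (n : ℕ) : (cons a l).nth (n + 1) = l.nth n := rfl

theorem nth_nil (n : ℕ) : nil.nth n = nil := by
  induction n with
  | zero => rfl
  | succ n ih => exact ih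

theorem size_iterate_cdr (l : Data) (n : ℕ) : size (cdr^[n] l) ≤ size l := by
  induction n generalizing l with
  | zero => simp
  | succ n ih => exact (ih l.cdr).trans l.size_cdr

theorem size_nth (l : Data) (n : ℕ) : size (l.nth n) ≤ size l :=
  (size_car _).trans (size_iterate_cdr l n)

theorem nth_set (l : Data) (n : ℕ) (v : Data) (m : ℕ) :
    (l.set n v).nth m = if m = n then v else l.nth m := by
  induction n generalizing l m with
  | zero => cases m <;> simp [set, car, nth_succ, cdr]
  | succ n ih => cases m <;> simp [set, car, nth_succ, cdr, ih]

/-- The size of the replaced entry is credited on the left, so that replacing a tape by a slightly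
longer one costs only the difference. The term `2 * n + 2` pays for padding when the list is too
short. -/
theorem size_set (l : Data) (n : ℕ) (v : Data) :
    size (l.set n v) + size (l.nth n) ≤ size l + size v + 2 * n + 2 := by
  have h : size l.car + size l.cdr ≤ size l + 1 := by
    cases l <;> simp [car, cdr]; omega
  induction n generalizing l with
  | zero => simp [set]; omega
  | succ n ih =>
    have := ih l.cdr (by cases l.cdr <;> simp [car, cdr]; omega)
    rw [nth_succ]
    simp [set]
    omega

/-- Move one entry from the second list to the front of the first. -/
def shift (p : Data × Data) : Data × Data := (cons p.2.car p.1, p.2.cdr)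

/-- Move one entry from the first list to the front of the second. -/
def unshift (p : Data × Data) : Data × Data := (p.1.cdr, cons p.1.car p.2)

/-- A zipper: `n` entries are moved to an auxiliary stack, the entry then on top is replaced, and
the `n` entries are moved back. This turns the recursion in `set` into two iterations. -/
theorem set_eq (l : Data) (n : ℕ) (v p : Data) :
    unshift^[n] ((shift^[n] (p, l)).1, cons v (shift^[n] (p, l)).2.cdr) = (p, l.set n v) := by
  induction n generalizing l p with
  | zero => rfl
  | succ n ih =>
    rw [Function.iterate_succ_apply', Function.iterate_succ_apply, shift]
    rw [ih]
    rfl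

end Data

namespace FP

variable {A : Language Bool} {α β γ δ : Type} [Enc α] [Enc β] [Enc γ] [Enc δ]

theorem nth {l n : α → Data} (hl : FP A l) (hn : FP A n) :
    FP A fun x => (l x).nth (n x).spine := by
  obtain ⟨T, hT⟩ := hl.size_le
  exact car.comp (iterate cdr hn hl T fun x i _ => (Data.size_iterate_cdr _ _).trans (hT x))

theorem shift : FP A Data.shift :=
  (dataCons (car.comp snd) fst).pair (cdr.comp snd)

theorem unshift : FP A Data.unshift :=
  (cdr.comp fst).pair (dataCons (car.comp fst) snd)

theorem set {l n v : α → Data} (hl : FP A l) (hn : FP A n) (hv : FP A v) :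
    FP A fun x => (l x).set (n x).spine (v x) := by
  have h1 : FP A fun x => Data.shift^[(n x).spine] (Data.nil, l x) :=
    iterate_add (g := fun s : α × Data × Data => Data.shift s.2) (shift.comp snd) hn
      ((const _).pair hl) 4 fun x y => by
        obtain ⟨p, l⟩ := y
        cases l <;> simp [Data.shift, Data.car, Data.cdr] <;> omega
  have h2 : FP A fun x => Data.unshift^[(n x).spine] ((Data.shift^[(n x).spine] (Data.nil, l x)).1,
      Data.cons (v x) (Data.shift^[(n x).spine] (Data.nil, l x)).2.cdr) :=
    iterate_add (g := fun s : α × Data × Data => Data.unshift s.2) (unshift.comp snd) hn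
      ((fst.comp h1).pair (dataCons hv (cdr.comp (snd.comp h1)))) 4 fun x y => by
        obtain ⟨p, l⟩ := y
        cases p <;> simp [Data.unshift, Data.car, Data.cdr] <;> omega
  exact (snd.comp h2).congr fun x => by rw [Data.set_eq]

end FP

/-- The word spelled by the entries of a list, up to the first entry that is not the code of a
bit. -/
def readWord : Data → List Bool
  | .nil => []
  | .cons s l =>
    if s.isNil then [] else
    if s.cdr.isNil then false :: readWord l else
    if s.cdr.cdr.isNil then true :: readWord l else []

/-- One step of the computation of `readWord`. -/
def readStep (s : Data × List Bool) : Data × List Bool :=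
  if s.1.car.isNil then (.nil, s.2) else
  if s.1.car.cdr.isNil then (s.1.cdr, false :: s.2) else
  if s.1.car.cdr.cdr.isNil then (s.1.cdr, true :: s.2) else (.nil, s.2)

theorem iterate_readStep_nil (n : ℕ) (acc : List Bool) : readStep^[n] (.nil, acc) = (.nil, acc) := by
  induction n with
  | zero => rfl
  | succ n ih => exact ih

theorem iterate_readStep (l : Data) (acc : List Bool) :
    (readStep^[l.spine] (l, acc)).2 = (readWord l).reverse ++ acc := by
  induction l generalizing acc with
  | nil => rfl
  | cons s l _ ih =>
    rw [Data.spine, Function.iterate_succ_apply]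
    rcases s with _ | ⟨a, _ | ⟨b, _ | ⟨c, d⟩⟩⟩ <;>
      simp [readStep, readWord, Data.isNil, Data.car, Data.cdr, iterate_readStep_nil, ih]

theorem FP.readStep {A : Language Bool} : FP A readStep :=
  have h1 : FP A fun s : Data × List Bool => s.1.car := car.comp fst
  have h2 : FP A fun s : Data × List Bool => s.1.cdr := cdr.comp fst
  have h3 : FP A fun s : Data × List Bool => (Data.nil, s.2) := (const _).pair snd
  ite_isNil h1 h3 (ite_isNil (cdr.comp h1) (h2.pair (cons (const _) snd))
    (ite_isNil (cdr.comp (cdr.comp h1)) (h2.pair (cons (const _) snd)) h3))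

theorem FP.readWord {A : Language Bool} : FP A readWord :=
  (reverse.comp (snd.comp (iterate_add (α := Data) (g := fun s : Data × Data × List Bool =>
    OracleComplexity.readStep s.2) (n := _root_.id) (c := fun l => (l, [])) (readStep.comp snd) FP.id
    (FP.id.pair (const _)) 8 fun x y => by
      obtain ⟨l, acc⟩ := y
      have : size l.cdr ≤ size l := l.size_cdr
      have := size_pos l
      simp only [OracleComplexity.readStep]
      split_ifs <;> simp <;> omega))).congr fun l => by
    simp [iterate_readStep]

/-- Move the head of a tape, which is represented by the list of the squares to the left of
the head and the list of the other squares. -/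
def moveHead (d l r : Data) : Data :=
  if d.isNil then .cons l.cdr (.cons l.car r) else
  if d.cdr.isNil then .cons l r else .cons (.cons r.car l) r.cdr

/-- The row of the table for the state of a configuration. -/
def simRow (x : Data × Data) : Data := x.1.nth x.2.car.spine

/-- The tape that is scanned. -/
def simTape (x : Data × Data) : Data := x.2.cdr.nth (simRow x).car.spine

/-- The instruction that is carried out. -/
def simInstr (x : Data × Data) : Data := (simRow x).cdr.nth (simTape x).cdr.car.spine

open Classical in
/-- One step of the machine with the table `x.1` in the configuration `x.2`. -/
noncomputable def simStep (A : Language Bool) (x : Data × Data) : Data :=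
  if (simInstr x).isNil then x.2 else
  if (simInstr x).car.isNil then
    .cons (if decide (readWord (x.2.cdr.nth 1).cdr ∈ A) then (simInstr x).cdr.car
      else (simInstr x).cdr.cdr) x.2.cdr
  else .cons (simInstr x).cdr (x.2.cdr.set (simRow x).car.spine
    (moveHead (simInstr x).car.cdr (simTape x).car
      (.cons (simInstr x).car.car (simTape x).cdr.cdr)))

/-- The output of a configuration, if the machine halts there. -/
def simOutput (x : Data × Data) : List Bool :=
  if (simInstr x).isNil then readWord (x.2.cdr.nth 2).cdr else []

/-- The initial configuration. -/
def simInit (w : List Bool) : Data :=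
  .cons .nil (.cons (.cons .nil (toData (w.map fun b => Data.num (if b then 2 else 1)))) .nil)

/-- Run the machine with the table `x.1` on the word `x.2.1` for `x.2.2.length` steps. -/
noncomputable def sim (A : Language Bool) (x : Data × List Bool × Data) : List Bool :=
  simOutput (x.1, (fun c => simStep A (x.1, c))^[x.2.2.spine] (simInit x.2.1))

/-! ### Polynomial-time computability of the simulation -/

section FP

variable {A : Language Bool}

theorem FP.moveHead {α : Type} [Enc α] {d l r : α → Data} (hd : FP A d) (hl : FP A l)
    (hr : FP A r) : FP A fun x => moveHead (d x) (l x) (r x) :=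
  ite_isNil hd (dataCons (cdr.comp hl) (dataCons (car.comp hl) hr))
    (ite_isNil (cdr.comp hd) (dataCons hl hr) (dataCons (dataCons (car.comp hr) hl) (cdr.comp hr)))

theorem FP.simRow : FP A simRow := nth fst (car.comp snd)

theorem FP.simTape : FP A simTape := nth (cdr.comp snd) (car.comp simRow)

theorem FP.simInstr : FP A simInstr := nth (cdr.comp simRow) (car.comp (cdr.comp simTape))

theorem FP.nth_const {α : Type} [Enc α] {l : α → Data} (hl : FP A l) (n : ℕ) :
    FP A fun x => (l x).nth n :=
  (nth hl (const (Data.num n))).congr fun x => by rw [Data.spine_num]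

theorem FP.simStep : FP A (simStep A) :=
  have hi : FP A OracleComplexity.simInstr := simInstr
  have ht : FP A OracleComplexity.simTape := simTape
  have hts : FP A fun x : Data × Data => x.2.cdr := cdr.comp snd
  ite_isNil hi snd (ite_isNil (car.comp hi)
    (dataCons (cond (mem_oracle.comp (readWord.comp (cdr.comp (nth_const hts 1))))
      (car.comp (cdr.comp hi)) (cdr.comp (cdr.comp hi))) hts)
    (dataCons (cdr.comp hi) (set hts (car.comp simRow) (moveHead (cdr.comp (car.comp hi))
      (car.comp ht) (dataCons (car.comp (car.comp hi)) (cdr.comp (cdr.comp ht)))))))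

theorem FP.simOutput : FP A simOutput :=
  ite_isNil simInstr (readWord.comp (cdr.comp (nth_const (cdr.comp snd) 2))) (const _)

theorem FP.simInit : FP A simInit :=
  dataCons (const _) (dataCons (dataCons (const _) (encode.comp
    (map (g := fun s : List Bool × Bool => Data.num (if s.2 then 2 else 1))
      ((cond snd (const (Data.num 2)) (const (Data.num 1))).congr fun s => by
        cases s.2 <;> rfl) FP.id))) (const _))

theorem size_moveHead (d l r : Data) : size (moveHead d l r) ≤ size l + size r + 3 := by
  unfold moveHead
  split_ifs
  · cases l <;> simp [Data.car, Data.cdr] <;> omega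
  · simp
  · cases r <;> simp [Data.car, Data.cdr] <;> omega

/-- The new state and symbol are parts of the table and a tape gains a bounded number of nodes
besides, so the growth is additive. This is the hypothesis of `FP.iterate_add` for `FP.sim`. -/
theorem size_simStep (x : Data × Data) : size (simStep A x) ≤ size x.2 + 4 * size x.1 + 10 := by
  have h1 : size (simRow x) ≤ size x.1 := Data.size_nth _ _
  have h2 : size (simInstr x) ≤ size (simRow x) :=
    (Data.size_nth _ _).trans (Data.size_cdr _)
  have h3 := (simInstr x).cdr.size_car
  have h4 := (simInstr x).cdr.size_cdr
  have h5 := (simInstr x).size_cdr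
  have h6 := (simInstr x).car.size_car
  have h7 := (simInstr x).size_car
  have h8 : size x.2.cdr ≤ size x.2 := x.2.size_cdr
  unfold simStep
  split_ifs
  · omega
  · simp; omega
  · simp; omega
  · have h9 := Data.size_set x.2.cdr (simRow x).car.spine
      (moveHead (simInstr x).car.cdr (simTape x).car
      (.cons (simInstr x).car.car (simTape x).cdr.cdr))
    have h10 := size_moveHead (simInstr x).car.cdr (simTape x).car
      (.cons (simInstr x).car.car (simTape x).cdr.cdr)
    have h11 : size (x.2.cdr.nth (simRow x).car.spine) = size (simTape x) := rfl
    have h12 := (simRow x).car.spine_le_size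
    have h13 := (simRow x).size_car
    have h14 : size (simTape x).car + size (simTape x).cdr.cdr ≤ size (simTape x) + 1 := by
      have := (simTape x).cdr.size_cdr
      cases h : simTape x <;> simp [h, Data.car, Data.cdr] at this ⊢
      omega
    simp at h10 ⊢
    omega

theorem FP.sim : FP A (sim A) :=
  simOutput.comp (fst.pair (iterate_add (γ := Data)
    (g := fun s : (Data × List Bool × Data) × Data => OracleComplexity.simStep A (s.1.1, s.2))
    (simStep.comp ((fst.comp fst).pair snd)) (snd.comp snd) (simInit.comp (fst.comp snd))
    (4 * .X + 10) fun x y => by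
      have := size_simStep (A := A) (x.1, y)
      obtain ⟨a, b⟩ := x
      simp at this ⊢
      omega))

end FP

/-! ### The tables of machines -/

/-- The tree that represents a symbol. -/
def symData {m : ℕ} : Symbol m → Data
  -- The blank must be the leaf: `Data.nth` returns a leaf past the end of a list, so finite lists
  -- represent infinite tapes.
  | .blank => .nil
  | .bit b => .num (if b then 2 else 1)
  | .aux i => .num (i + 3)

/-- The tree that represents a head movement. -/
def moveData : Move → Data
  | .left => .num 0
  | .stay => .num 1
  | .right => .num 2

/-- The tree that represents an instruction or its absence. -/
def instrData {n m : ℕ} : Option (Instr (Fin n) (Symbol m)) → Data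
  | none => .nil
  | some (.query yes no) => .cons .nil (.cons (.num yes) (.num no))
  | some (.act a d q) => .cons (.cons (symData a) (moveData d)) (.num q)

theorem nth_toData {α : Type} [Enc α] (l : List α) (n : ℕ) :
    (toData l).nth n = (l[n]?).elim .nil toData := by
  induction l generalizing n with
  | nil => exact Data.nth_nil n
  | cons a l ih =>
    cases n with
    | zero => rfl
    | succ n => simpa using ih n

namespace OracleTM

variable (M : OracleTM)

/-- The table of the instructions for a state. -/
def row (q : Fin (M.numStates + 1)) : Data :=
  .cons (.num (M.scan q)) (toData (instrData (M.instr q .blank) ::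
    instrData (M.instr q (.bit false)) :: instrData (M.instr q (.bit true)) ::
      List.ofFn fun i => instrData (M.instr q (.aux i))))

/-- The table of a machine. -/
def table : Data := toData (List.ofFn M.row)

theorem nth_table (q : Fin (M.numStates + 1)) : M.table.nth q = M.row q := by
  have hq : (q : ℕ) ≤ M.numStates := Nat.lt_succ_iff.1 q.2
  simp [table, nth_toData, -List.ofFn_succ, hq]

theorem nth_row (q : Fin (M.numStates + 1)) (a : Symbol M.numAux) :
    (M.row q).cdr.nth (symData a).spine = instrData (M.instr q a) := by
  simp only [row, Data.cdr, nth_toData]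
  rcases a with _ | (_ | _) | i <;> simp [symData, Data.spine]

end OracleTM

/-- The tree `t` represents the tape `T`. -/
def TapeRep {m : ℕ} (T : Turing.Tape (Symbol m)) (t : Data) : Prop :=
  ∀ i : ℕ, t.cdr.nth i = symData (T.nth i) ∧ t.car.nth i = symData (T.nth (-(i + 1 : ℤ)))

namespace TapeRep

variable {m : ℕ} {T : Turing.Tape (Symbol m)} {t : Data}

theorem head (h : TapeRep T t) : t.cdr.car = symData T.head := (h 0).1

theorem write (h : TapeRep T t) (a : Symbol m) :
    TapeRep (T.write a) (.cons t.car (.cons (symData a) t.cdr.cdr)) := by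
  intro i
  rw [Turing.Tape.write_nth, Turing.Tape.write_nth]
  constructor
  · cases i with
    | zero => simp [Data.cdr, Data.car]
    | succ i =>
      have h0 : ((i : ℤ) + 1) ≠ 0 := by omega
      have := (h (i + 1)).1
      simp only [Nat.cast_add, Nat.cast_one, h0, if_false] at this ⊢
      exact this
  · rw [if_neg (by omega)]
    exact (h i).2

theorem move {l r : Data} (h : TapeRep T (.cons l r)) (d : Move) :
    TapeRep (d.apply T) (moveHead (moveData d) l r) := by
  cases d with
  | stay => exact h
  | left =>
    intro i
    simp only [Move.apply, Turing.Tape.move_left_nth]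
    constructor
    · cases i with
      | zero => exact (h 0).2
      | succ i => simpa [moveHead, moveData, Data.num] using (h i).1
    · have := (h (i + 1)).2
      rw [show (-((i : ℤ) + 1) - 1) = (-(((i + 1 : ℕ) : ℤ) + 1)) by push_cast; ring]
      exact this
  | right =>
    intro i
    simp only [Move.apply, Turing.Tape.move_right_nth]
    constructor
    · have := (h (i + 1)).1
      push_cast at this
      exact this
    · cases i with
      | zero => simpa [moveHead, moveData, Data.num] using (h 0).1
      | succ i =>
        have := (h i).2
        rw [show (-(((i + 1 : ℕ) : ℤ) + 1) + 1) = (-((i : ℤ) + 1)) by push_cast; ring]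
        exact this

theorem blank : TapeRep (m := m) (Turing.Tape.mk₁ []) .nil := by
  intro i
  have : ∀ j : ℤ, (Turing.Tape.mk₁ [] : Turing.Tape (Symbol m)).nth j = .blank := by
    rintro ((_ | j) | (_ | j)) <;> rfl
  rw [this, this]
  exact ⟨Data.nth_nil i, Data.nth_nil i⟩

theorem input (w : List Bool) : TapeRep (m := m) (Turing.Tape.mk₁ (w.map Symbol.bit))
    (.cons .nil (toData (w.map fun b => Data.num (if b then 2 else 1)))) := by
  intro i
  constructor
  · simp only [Data.cdr, nth_toData, List.getElem?_map]
    cases i with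
    | zero => cases w <;> simp [Turing.Tape.mk₁, Turing.Tape.mk₂, Turing.Tape.mk', default, symData]
    | succ i =>
      change _ = symData (Turing.ListBlank.nth
        (Turing.ListBlank.mk (w.map Symbol.bit)).tail i)
      cases w with
      | nil => simp [Turing.ListBlank.nth_mk, default, Turing.ListBlank.tail_mk, symData]
      | cons b l =>
        simp only [List.map_cons, Turing.ListBlank.tail_mk, List.tail_cons,
          Turing.ListBlank.nth_mk, List.getElem?_cons_succ]
        rw [List.getI_eq_getElem?_getD]
        cases h : l[i]? <;> simp [h, default, symData]
  · have : (Turing.Tape.mk₁ (w.map Symbol.bit) : Turing.Tape (Symbol m)).nth (-(i + 1 : ℤ)) =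
        .blank := by
      rw [show (-(i + 1 : ℤ)) = Int.negSucc i by omega]
      cases i <;> rfl
    rw [this]
    exact Data.nth_nil i

/-- Stated for a sequence `f` of symbols instead of a tape, so that the induction can pass to the
shifted sequence. -/
theorem readWord_spec {f : ℕ → Symbol m} {r : Data} (h : ∀ i, r.nth i = symData (f i)) :
    (∀ (i : ℕ) (hi : i < (readWord r).length), f i = Symbol.bit (readWord r)[i]) ∧
      ∀ b : Bool, f (readWord r).length ≠ Symbol.bit b := by
  induction r generalizing f with
  | nil =>
    refine ⟨fun i hi => by simp [readWord] at hi, fun b hb => ?_⟩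
    have := h 0
    simp only [readWord, List.length_nil] at hb
    rw [hb] at this
    cases b <;> simp [symData, Data.num, Data.car] at this
  | cons s l _ ih =>
    have h0 : s = symData (f 0) := h 0
    obtain ⟨h1, h2⟩ := ih (f := fun i => f (i + 1)) fun i => h (i + 1)
    rcases hf : f 0 with _ | (_ | _) | j
    · have : readWord (s.cons l) = [] := by
        rw [h0, hf]; simp [readWord, symData, Data.isNil]
      rw [this]
      exact ⟨fun i hi => by simp at hi, fun b => by simp [hf]⟩
    · have : readWord (s.cons l) = false :: readWord l := by
        rw [h0, hf]; simp [readWord, symData, Data.isNil, Data.num, Data.cdr]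
      rw [this]
      refine ⟨fun i hi => ?_, h2⟩
      cases i with
      | zero => exact hf
      | succ i => exact h1 i (by simpa using hi)
    · have : readWord (s.cons l) = true :: readWord l := by
        rw [h0, hf]; simp [readWord, symData, Data.isNil, Data.num, Data.cdr]
      rw [this]
      refine ⟨fun i hi => ?_, h2⟩
      cases i with
      | zero => exact hf
      | succ i => exact h1 i (by simpa using hi)
    · have : readWord (s.cons l) = [] := by
        rw [h0, hf]; simp [readWord, symData, Data.isNil, Data.num, Data.cdr]
      rw [this]
      exact ⟨fun i hi => by simp at hi, fun b => by simp [hf]⟩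

theorem holds_unique {w w' : List Bool} (h : Holds T w) (h' : Holds T w') : w = w' := by
  have key : ∀ {w w' : List Bool}, Holds T w → Holds T w' → w.length ≤ w'.length := by
    intro w w' h h'
    by_contra hlt
    push Not at hlt
    exact h'.2 _ (h.1 _ hlt)
  refine List.ext_getElem (le_antisymm (key h h') (key h' h)) fun i h1 h2 => ?_
  have := (h.1 i h1).symm.trans (h'.1 i h2)
  simpa using this

theorem holds_iff (h : TapeRep T t) (w : List Bool) : Holds T w ↔ w = readWord t.cdr := by
  have := readWord_spec (f := fun i : ℕ => T.nth i) fun i => (h i).1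
  exact ⟨fun hw => holds_unique hw this, fun hw => hw ▸ this⟩

end TapeRep

/-! ### Correctness of the simulation -/

section simulation

variable {M : OracleTM} {A : Language Bool}

/-- The tree `d` represents the configuration `c`. -/
def CfgRep (c : M.Cfg) (d : Data) : Prop :=
  d.car = .num c.state ∧ ∀ k, TapeRep (c.tape k) (d.cdr.nth k)

theorem CfgRep.init (w : List Bool) : CfgRep (M.init w) (simInit w) := by
  refine ⟨rfl, fun k => ?_⟩
  simp only [OracleTM.init, simInit, Data.cdr]
  split_ifs with hk
  · subst hk
    exact TapeRep.input w
  · obtain ⟨j, hj⟩ := Nat.exists_eq_succ_of_ne_zero (n := k.val) fun h => hk (Fin.ext h)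
    rw [hj, Nat.succ_eq_add_one, Data.nth_cons_succ, Data.nth_nil]
    exact TapeRep.blank

theorem CfgRep.simRow_eq {c : M.Cfg} {d : Data} (h : CfgRep c d) :
    simRow (M.table, d) = M.row c.state := by
  simp only [simRow]
  rw [h.1, Data.spine_num, M.nth_table]

theorem CfgRep.tapeRep {c : M.Cfg} {d : Data} (h : CfgRep c d) :
    TapeRep (c.tape (M.scan c.state)) (simTape (M.table, d)) := by
  rw [simTape, h.simRow_eq]
  simp only [OracleTM.row, Data.car, Data.spine_num]
  exact h.2 _

theorem CfgRep.simInstr_eq {c : M.Cfg} {d : Data} (h : CfgRep c d) :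
    simInstr (M.table, d) = instrData (M.instr c.state (c.tape (M.scan c.state)).head) := by
  rw [simInstr, h.tapeRep.head, h.simRow_eq, M.nth_row]

theorem CfgRep.isNil_iff {c : M.Cfg} {d : Data} (h : CfgRep c d) :
    (simInstr (M.table, d)).isNil = true ↔ M.step A c = none := by
  rw [h.simInstr_eq]
  unfold OracleTM.step
  rcases M.instr c.state (c.tape (M.scan c.state)).head with _ | _ | _ <;>
    simp [instrData, Data.isNil]

theorem CfgRep.simStep_of_none {c : M.Cfg} {d : Data} (h : CfgRep c d)
    (hc : M.step A c = none) : simStep A (M.table, d) = d := by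
  rw [simStep, if_pos (h.isNil_iff.2 hc)]

theorem CfgRep.simStep_of_some {c c' : M.Cfg} {d : Data} (h : CfgRep c d)
    (hc : M.step A c = some c') : CfgRep c' (simStep A (M.table, d)) := by
  have h1 := h.simInstr_eq
  unfold OracleTM.step at hc
  rcases hi : M.instr c.state (c.tape (M.scan c.state)).head with _ | ⟨a, m, q⟩ | ⟨yes, no⟩
  · rw [hi] at hc
    cases hc
  · rw [hi] at hc h1
    simp only [Option.some.injEq] at hc
    subst hc
    rw [simStep, h1]
    simp only [instrData, Data.isNil_cons, Data.car_cons, Data.cdr_cons]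
    refine ⟨rfl, fun k => ?_⟩
    have h2 : (simRow (M.table, d)).car.spine = M.scan c.state := by
      rw [h.simRow_eq]; simp [OracleTM.row, Data.car]
    simp only [Bool.false_eq_true, if_false]
    change TapeRep _ ((d.cdr.set _ _).nth k)
    rw [Data.nth_set, h2]
    by_cases hk : k = M.scan c.state
    · subst hk
      rw [Function.update_self, if_pos rfl]
      exact (h.tapeRep.write a).move m
    · rw [Function.update_of_ne hk, if_neg fun hk' => hk (Fin.ext hk')]
      exact h.2 k
  · rw [hi] at hc h1
    simp only [Option.some.injEq] at hc
    subst hc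
    rw [simStep, h1]
    have h2 : (∃ w ∈ A, Holds (c.tape 1) w) ↔ readWord (d.cdr.nth 1).cdr ∈ A := by
      have h3 := (h.2 1).holds_iff
      have h4 : ((1 : Fin (M.numTapes + 3)) : ℕ) = 1 := rfl
      rw [h4] at h3
      constructor
      · rintro ⟨w, hw, hh⟩
        rwa [← (h3 w).1 hh]
      · exact fun hw => ⟨_, hw, (h3 _).2 rfl⟩
    simp only [instrData, Data.isNil_cons, Data.isNil_nil, Data.car_cons, Data.cdr_cons,
      Bool.false_eq_true, if_false, if_true, decide_eq_true_eq]
    refine ⟨?_, h.2⟩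
    by_cases hw : readWord (d.cdr.nth 1).cdr ∈ A
    · simp [hw, h2.2 hw]
    · have hw' := mt h2.1 hw
      simp [hw, hw']

theorem CfgRep.iterate_of_steps {c c' : M.Cfg} {d : Data} (h : CfgRep c d) {n : ℕ}
    (hc : M.steps A n c = some c') : CfgRep c' ((fun y => simStep A (M.table, y))^[n] d) := by
  induction n generalizing c d with
  | zero =>
    rw [OracleTM.steps_zero, Option.some.injEq] at hc
    subst hc
    exact h
  | succ n ih =>
    rw [OracleTM.steps_succ] at hc
    rcases hs : M.step A c with _ | c''
    · rw [hs] at hc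
      cases hc
    · rw [hs] at hc
      exact ih (h.simStep_of_some hs) hc

/-- A simulated machine that has halted stays in its configuration, so `n` simulated steps always
correspond to some `m ≤ n` real ones. -/
theorem CfgRep.exists_steps {c : M.Cfg} {d : Data} (h : CfgRep c d) (n : ℕ) :
    ∃ m ≤ n, ∃ c', M.steps A m c = some c' ∧
      CfgRep c' ((fun y => simStep A (M.table, y))^[n] d) := by
  induction n generalizing c d with
  | zero => exact ⟨0, le_rfl, c, rfl, h⟩
  | succ n ih =>
    rcases hs : M.step A c with _ | c''
    · refine ⟨0, Nat.zero_le _, c, rfl, ?_⟩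
      rwa [Function.iterate_fixed (h.simStep_of_none hs)]
    · obtain ⟨m, hm, c', h1, h2⟩ := ih (h.simStep_of_some hs)
      refine ⟨m + 1, by omega, c', ?_, h2⟩
      rw [OracleTM.steps_succ, hs]
      exact h1

/-- The simulation returns the empty word if the machine has not halted, so a one-letter result is
evidence that it halted in time with this output. -/
theorem sim_eq_iff (w : List Bool) (n : Data) (b : Bool) :
    sim A (M.table, w, n) = [b] ↔ M.Outputs A w [b] n.spine := by
  constructor
  · intro h
    obtain ⟨m, hm, c, h1, h2⟩ := (CfgRep.init (M := M) w).exists_steps (A := A) n.spine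
    simp only [sim, simOutput] at h
    split_ifs at h with hn
    exact ⟨m, hm, c, h1, (h2.isNil_iff).1 hn, ((h2.2 2).holds_iff _).2 h.symm⟩
  · rintro ⟨m, hm, c, h1, h2, h3⟩
    have h4 := (CfgRep.init (M := M) w).iterate_of_steps h1
    obtain ⟨k, hk⟩ := Nat.exists_eq_add_of_le hm
    have h5 : (fun y => simStep A (M.table, y))^[n.spine] (simInit w) =
        (fun y => simStep A (M.table, y))^[m] (simInit w) := by
      rw [hk, Nat.add_comm, Function.iterate_add_apply,
        Function.iterate_fixed (h4.simStep_of_none h2)]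
    simp only [sim, simOutput]
    rw [h5, if_pos ((h4.isNil_iff).2 h2)]
    exact (((h4.2 2).holds_iff _).1 h3).symm

end simulation

/-! ### The martingale -/

/-- The successor in shortlex order, for words with their last letter first. -/
def inc : List Bool → List Bool
  | [] => [false]
  | false :: l => true :: l
  | true :: l => false :: inc l

/-- One step of a parser for trees in postfix notation. -/
def parseStep (s : List Data) (b : Bool) : List Data :=
  if b then .cons s.tail.headI s.headI :: s.tail.tail else .nil :: s

/-- The tree with the given postfix notation. -/
def parse (l : List Bool) : Data := (l.foldl parseStep []).headI

/-- The new capital, in units that are half as large, of a gambler with capital `c`, whose bet is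
`l`, when the bit is `b`. -/
def newCapital (l : List Bool) (b : Bool) (c : List Bool) : List Bool :=
  -- With the least significant digit first, a prepended `false` doubles. In the halved unit, `2 *
  -- c` means no bet, `4 * c` a doubled capital and the empty word ruin; only a one-letter `l`
  -- counts as a bet.
  if l.isEmpty then false :: c else
  if l.tail.isEmpty then (if l.headI == b then false :: false :: c else []) else false :: c

/-- The state of the gamblers: the next word, with its last letter first, and the gamblers, each
with a program and a capital. -/
abbrev Gamblers := List Bool × List (List Bool × List Bool)

/-- The bet of the gambler with program `e`. -/
noncomputable def bet (A : Language Bool) (s : Gamblers) (e : List Bool) : List Bool :=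
  -- The list of gamblers serves as a clock: its spine has one cell for each bit read so far.
  sim A (parse e, s.1.reverse, toData s.2)

/-- The next state of the gamblers, if the bit is `b`. -/
noncomputable def Gamblers.next (A : Language Bool) (s : Gamblers) (b : Bool) : Gamblers :=
  -- The current word becomes the program of a new gambler, whose capital is one new unit.
  (inc s.1, (s.1, [true]) :: s.2.map fun e => (e.1, newCapital (bet A s e.1) b e.2))

/-- The state of the gamblers after the bits of `σ`. -/
noncomputable def gamblers (A : Language Bool) (σ : List Bool) : Gamblers :=
  σ.foldl (Gamblers.next A) ([], [])

/-- One step of binary addition: the state consists of the carry, the remaining digits and the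
digits of the sum, with the last one first. -/
def addStep (s : Bool × List Bool × List Bool × List Bool) :
    Bool × List Bool × List Bool × List Bool :=
  ((if s.1 then s.2.1.headI || s.2.2.1.headI else s.2.1.headI && s.2.2.1.headI), s.2.1.tail,
    s.2.2.1.tail, (s.1 ^^ (s.2.1.headI ^^ s.2.2.1.headI)) :: s.2.2.2)

/-- Binary addition. -/
def add (u v : List Bool) : List Bool :=
  (addStep^[u.length + v.length + 1] (false, u, v, [])).2.2.2.reverse

/-- One plus the sum of the capitals of the gamblers. -/
def total (l : List (List Bool × List Bool)) : List Bool :=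
  l.foldl (fun u e => add u e.2) [true]

/-- The representation of the value of the martingale. -/
noncomputable def martingaleCode (A : Language Bool) (σ : List Bool) : List Bool :=
  false :: ((total (gamblers A σ).2).flatMap (fun b => [b, b]) ++ [false, true] ++
    (σ.map (fun _ => false) ++ [true]))

/-! ### Polynomial-time computability of the martingale -/

section FP

variable {A : Language Bool} {α : Type} [Enc α]

theorem FP.bool₂ (f : Bool → Bool → Bool) {x y : α → Bool} (hx : FP A x) (hy : FP A y) :
    FP A fun a => f (x a) (y a) :=
  (cond hx (cond hy (const (f true true)) (const (f true false)))
    (cond hy (const (f false true)) (const (f false false)))).congr fun a => by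
      cases x a <;> cases y a <;> rfl

/-- One step of the computation of `inc`. -/
def incStep (s : Bool × List Bool) (b : Bool) : Bool × List Bool :=
  (s.1 && b, (s.1 ^^ b) :: s.2)

theorem foldl_incStep_false (l r : List Bool) :
    l.foldl incStep (false, r) = (false, l.reverse ++ r) := by
  induction l generalizing r with
  | nil => rfl
  | cons b l ih => simp [incStep, ih]

theorem foldl_incStep_true (l r : List Bool) :
    (if (l.foldl incStep (true, r)).1 then false :: (l.foldl incStep (true, r)).2
      else (l.foldl incStep (true, r)).2) = (inc l).reverse ++ r := by
  induction l generalizing r with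
  | nil => rfl
  | cons b l ih => cases b <;> simp [incStep, ih, inc, foldl_incStep_false]

theorem FP.inc : FP A inc := by
  have h : FP A fun l : List Bool => l.foldl incStep (true, []) :=
    foldl_add (g := fun s : List Bool × (Bool × List Bool) × Bool => incStep s.2.1 s.2.2)
      (l := _root_.id) ((bool₂ and (fst.comp (fst.comp snd)) (snd.comp snd)).pair
        (cons (bool₂ xor (fst.comp (fst.comp snd)) (snd.comp snd)) (snd.comp (fst.comp snd))))
      FP.id (const _) 6 fun x y b _ => by
        obtain ⟨c, y⟩ := y
        simp [incStep]
        omega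
  refine (reverse.comp (cond (fst.comp h) (cons (const false) (snd.comp h)) (snd.comp h))).congr
    fun l => ?_
  rw [foldl_incStep_true]
  simp

theorem FP.parse : FP A parse :=
  headI.comp (foldl_add (α := List Bool) (g := fun s : List Bool × List Data × Bool =>
    parseStep s.2.1 s.2.2) (l := _root_.id) (c := fun _ => [])
    (cond (snd.comp snd)
      (cons (dataCons (headI.comp (tail.comp (fst.comp snd))) (headI.comp (fst.comp snd)))
        (tail.comp (tail.comp (fst.comp snd))))
      (cons (const _) (fst.comp snd))) FP.id (const _) 5 fun x s b _ => by
        rcases s with _ | ⟨a, _ | ⟨a', s⟩⟩ <;> cases b <;>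
          simp [parseStep, List.headI, default] <;> omega)

theorem FP.newCapital {l c : α → List Bool} {b : α → Bool} (hl : FP A l) (hb : FP A b)
    (hc : FP A c) : FP A fun x => newCapital (l x) (b x) (c x) :=
  ite_nil hl (cons (const _) hc) (ite_nil (tail.comp hl)
    (cond (bool₂ (· == ·) (headI.comp hl) hb) (cons (const _) (cons (const _) hc)) (const _))
    (cons (const _) hc))

theorem FP.gamblersNext : FP A fun s : Gamblers × Bool => s.1.next A s.2 :=
  (inc.comp (fst.comp fst)).pair (cons ((fst.comp fst).pair (const _))
    (map (g := fun t : (Gamblers × Bool) × (List Bool × List Bool) =>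
      (t.2.1, OracleComplexity.newCapital (bet A t.1.1 t.2.1) t.1.2 t.2.2))
      ((fst.comp snd).pair (newCapital (sim.comp ((parse.comp (fst.comp snd)).pair
        ((reverse.comp (fst.comp (fst.comp fst))).pair (encode.comp (snd.comp (fst.comp fst))))))
        (snd.comp fst) (snd.comp snd))) (snd.comp fst)))

theorem length_inc (l : List Bool) : (inc l).length ≤ l.length + 1 := by
  induction l with
  | nil => simp [inc]
  | cons b l ih => cases b <;> simp [inc, ih]

theorem length_newCapital (l : List Bool) (b : Bool) (c : List Bool) :
    (newCapital l b c).length ≤ c.length + 2 := by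
  unfold newCapital
  split_ifs <;> simp

theorem gamblers_concat (σ : List Bool) (b : Bool) :
    gamblers A (σ ++ [b]) = (gamblers A σ).next A b := by
  simp [gamblers]

/-- Bets affect the capitals but are not stored. Every capital gains at most two digits per bit and
one gambler joins per bit, so the state has polynomial size. This supplies the bound on the fold in
`FP.gamblers`. -/
theorem gamblers_bound (σ : List Bool) : (gamblers A σ).1.length ≤ σ.length ∧
    (gamblers A σ).2.length = σ.length ∧ ∀ e ∈ (gamblers A σ).2,
      e.1.length ≤ σ.length ∧ e.2.length ≤ 2 * σ.length := by
  induction σ using List.reverseRecOn with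
  | nil => simp [gamblers]
  | append_singleton σ b ih =>
    obtain ⟨h1, h2, h3⟩ := ih
    rw [gamblers_concat]
    refine ⟨?_, ?_, ?_⟩
    · have := length_inc (gamblers A σ).1
      simp [Gamblers.next]
      omega
    · simp [Gamblers.next, h2]
    · intro e he
      simp only [Gamblers.next, List.mem_cons, List.mem_map, List.length_append,
        List.length_singleton] at he ⊢
      rcases he with rfl | ⟨e, he, rfl⟩
      · simp
        omega
      · have := length_newCapital (bet A (gamblers A σ) e.1) b e.2
        have := h3 e he
        simp only
        omega

theorem size_list_le {β : Type} [Enc β] {l : List β} {K : ℕ} (h : ∀ b ∈ l, size b ≤ K) :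
    size l ≤ l.length * (K + 1) + 1 := by
  induction l with
  | nil => simp
  | cons b l ih =>
    have h1 := ih fun b hb => h b (List.mem_cons_of_mem _ hb)
    have h2 := h b List.mem_cons_self
    rw [size_cons, List.length_cons, Nat.add_mul]
    omega

theorem FP.gamblers : FP A (gamblers A) := by
  refine foldl (g := fun s : List Bool × Gamblers × Bool => s.2.1.next A s.2.2)
    (l := _root_.id) (gamblersNext.comp snd) FP.id (const _)
    (6 * .X + 1 + (.X * (18 * .X + 4) + 1) + 1) fun σ i => ?_
  obtain ⟨h1, h2, h3⟩ := gamblers_bound (A := A) (σ.take i)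
  have h4 : (σ.take i).length ≤ size σ := le_trans (by simp) (length_le_size σ)
  -- A program of length at most `N` and a capital of length at most `2 * N` have sizes at most `6 *
  -- N + 1` and `12 * N + 1`; the pair adds one.
  have h5 := size_list_le (l := (OracleComplexity.gamblers A (σ.take i)).2) (K := 18 * size σ + 3)
    fun e he => by
      obtain ⟨e, c⟩ := e
      have := h3 _ he
      rw [size_pair, size_word e, size_word c]
      simp only at this
      omega
  have h6 : (OracleComplexity.gamblers A (σ.take i)).2.length * (18 * size σ + 3 + 1) ≤
      size σ * (18 * size σ + 4) := Nat.mul_le_mul_right _ (by omega)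
  have h7 := size_word (OracleComplexity.gamblers A (σ.take i)).1
  change size (OracleComplexity.gamblers A (σ.take i)) ≤ _
  have h8 : size (OracleComplexity.gamblers A (σ.take i)) =
    size (OracleComplexity.gamblers A (σ.take i)).1 + size (OracleComplexity.gamblers A (σ.take i)).2 + 1 := size_pair _ _
  simp only [Polynomial.eval_add, Polynomial.eval_mul, Polynomial.eval_ofNat,
      Polynomial.eval_one, Polynomial.eval_X]
  omega

theorem FP.addStep : FP A addStep :=
  have hu : FP A fun s : Bool × List Bool × List Bool × List Bool => s.2.1 := fst.comp snd
  have hv : FP A fun s : Bool × List Bool × List Bool × List Bool => s.2.2.1 :=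
    fst.comp (snd.comp snd)
  (cond fst (bool₂ or (headI.comp hu) (headI.comp hv)) (bool₂ and (headI.comp hu)
    (headI.comp hv))).pair ((tail.comp hu).pair ((tail.comp hv).pair
      (cons (bool₂ xor fst (bool₂ xor (headI.comp hu) (headI.comp hv))) (snd.comp (snd.comp snd)))))

theorem FP.add : FP A fun s : List Bool × List Bool => add s.1 s.2 := by
  have hn : FP A fun s : List Bool × List Bool => toData (false :: (s.1 ++ s.2)) :=
    encode.comp (cons (const _) (append fst snd))
  refine (reverse.comp (snd.comp (snd.comp (snd.comp (iterate_add
    (γ := Bool × List Bool × List Bool × List Bool)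
    (g := fun s : (List Bool × List Bool) × Bool × List Bool × List Bool × List Bool =>
      OracleComplexity.addStep s.2)
    (c := fun s => (false, s.1, s.2, [])) (addStep.comp snd) hn
    ((const _).pair (fst.pair (snd.pair (const _)))) 6 fun x y => ?_))))).congr fun s => ?_
  · obtain ⟨c, u, v, w⟩ := y
    simp [OracleComplexity.addStep, size_word]
    omega
  · rw [Data.spine_toData]
    simp [OracleComplexity.add]

/-- Sums are not trimmed. Each addend contributes its length plus one, which is additive growth as
required by `FP.foldl_add`. -/
theorem length_add (u v : List Bool) : (add u v).length = u.length + v.length + 1 := by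
  have : ∀ n s, (addStep^[n] s).2.2.2.length = s.2.2.2.length + n := by
    intro n
    induction n with
    | zero => simp
    | succ n ih => intro s; rw [Function.iterate_succ_apply, ih]; simp [addStep]; omega
  rw [add, List.length_reverse, this]
  simp

theorem FP.total : FP A total := by
  have h : FP A fun s : List (List Bool × List Bool) × List Bool × List Bool × List Bool =>
      OracleComplexity.add s.2.1 s.2.2.2 :=
    comp (g := fun s : List Bool × List Bool => OracleComplexity.add s.1 s.2)
      (f := fun s : List (List Bool × List Bool) × List Bool × List Bool × List Bool =>
        (s.2.1, s.2.2.2)) add ((fst.comp snd).pair (snd.comp (snd.comp snd)))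
  refine foldl_add (α := List (List Bool × List Bool)) (γ := List Bool)
    (g := fun s : List (List Bool × List Bool) × List Bool × List Bool × List Bool =>
      OracleComplexity.add s.2.1 s.2.2.2) (l := _root_.id) (c := fun _ => [true])
    h FP.id (const _) (.X + 6)
    fun x y e he => ?_
  have h1 := size_le_of_mem (l := x) he
  obtain ⟨e, c⟩ := e
  simp [size_word, length_add] at h1 ⊢
  omega

theorem FP.double : FP A fun u : List Bool => u.flatMap fun b => [b, b] :=
  (foldl_add (α := List Bool) (γ := List Bool) (g := fun s : List Bool × List Bool × Bool =>
    s.2.2 :: s.2.2 :: s.2.1) (l := List.reverse) (c := fun _ => [])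
    (cons (snd.comp snd) (cons (snd.comp snd) (fst.comp snd))) reverse (const _) 12
    fun x y b _ => by simp; omega).congr fun u => by
      rw [List.foldl_reverse]
      congr 1
      induction u with
      | nil => rfl
      | cons b u ih => simp [ih]

theorem FP.martingaleCode : FP A (martingaleCode A) :=
  cons (const _) (append (append (double.comp (total.comp (snd.comp gamblers))) (const _))
    (append (map (g := fun _ : List Bool × Bool => false) (const _) FP.id) (const _)))

end FP

/-! ### Values of binary numerals -/

@[simp] theorem binValue_nil : binValue [] = 0 := rfl

@[simp] theorem binValue_cons (b : Bool) (u : List Bool) :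
    binValue (b :: u) = b.toNat + 2 * binValue u := by
  simp [binValue, Nat.ofDigits_cons]

theorem binValue_append (u v : List Bool) :
    binValue (u ++ v) = binValue u + 2 ^ u.length * binValue v := by
  simp [binValue, Nat.ofDigits_append]

/-- The invariant of binary addition: the digits produced so far, plus the carry and the remaining
digits at their place value. -/
theorem addStep_value (s : Bool × List Bool × List Bool × List Bool) :
    binValue (addStep s).2.2.2.reverse + 2 ^ (addStep s).2.2.2.length *
      ((addStep s).1.toNat + binValue (addStep s).2.1 + binValue (addStep s).2.2.1) =
    binValue s.2.2.2.reverse + 2 ^ s.2.2.2.length *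
      (s.1.toNat + binValue s.2.1 + binValue s.2.2.1) := by
  obtain ⟨c, u, v, w⟩ := s
  have h : ∀ u : List Bool, binValue u = u.headI.toNat + 2 * binValue u.tail := by
    rintro (_ | ⟨b, u⟩)
    · rfl
    · simp
  simp only [addStep, List.reverse_cons, binValue_append, List.length_reverse, List.length_cons]
  rw [h u, h v]
  cases c <;> cases u.headI <;> cases v.headI <;> simp <;> ring

theorem binValue_add (u v : List Bool) : binValue (add u v) = binValue u + binValue v := by
  have h1 : ∀ n s, binValue (addStep^[n] s).2.2.2.reverse + 2 ^ (addStep^[n] s).2.2.2.length *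
      ((addStep^[n] s).1.toNat + binValue (addStep^[n] s).2.1 + binValue (addStep^[n] s).2.2.1) =
      binValue s.2.2.2.reverse + 2 ^ s.2.2.2.length *
      (s.1.toNat + binValue s.2.1 + binValue s.2.2.1) := by
    intro n
    induction n with
    | zero => simp
    | succ n ih => intro s; rw [Function.iterate_succ_apply', addStep_value, ih]
  have h2 : ∀ n s, (addStep^[n] s).2.1 = s.2.1.drop n ∧ (addStep^[n] s).2.2.1 = s.2.2.1.drop n := by
    intro n
    induction n with
    | zero => simp
    | succ n ih => intro s; rw [Function.iterate_succ_apply']; simp [addStep, ih]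
  have h3 := h1 (u.length + v.length + 1) (false, u, v, [])
  obtain ⟨h4, h5⟩ := h2 (u.length + v.length + 1) (false, u, v, [])
  -- Both numerals are used up before the last step, which therefore absorbs the carry.
  have h6 : (addStep^[u.length + v.length + 1] (false, u, v, [])).1 = false := by
    obtain ⟨h4, h5⟩ := h2 (u.length + v.length) (false, u, v, [])
    rw [Function.iterate_succ_apply']
    simp only [addStep]
    rw [h4, h5, List.drop_eq_nil_of_le (by simp), List.drop_eq_nil_of_le (by simp)]
    split_ifs <;> rfl
  rw [h4, h5, h6, List.drop_eq_nil_of_le (by simp; omega), List.drop_eq_nil_of_le (by simp; omega)]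
    at h3
  simpa [add] using h3

theorem binValue_total (l : List (List Bool × List Bool)) :
    binValue (total l) = 1 + (l.map fun e => binValue e.2).sum := by
  have : ∀ (l : List (List Bool × List Bool)) u,
      binValue (l.foldl (fun u e => add u e.2) u) =
        binValue u + (l.map fun e => binValue e.2).sum := by
    intro l
    induction l with
    | nil => simp
    | cons e l ih => intro u; simp [ih, binValue_add]; ring
  rw [total, this]
  rfl

/-- The factor is four, not two, because the new capitals are counted in units half as large. -/
theorem newCapital_fair (l c : List Bool) :
    binValue (newCapital l false c) + binValue (newCapital l true c) = 4 * binValue c := by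
  unfold newCapital
  split_ifs with h1 h2 h3 h4 h5 <;> simp_all <;> omega

theorem newCapital_le {l : List Bool} {b : Bool} (h : ∀ b', l = [b'] → b' = b) (c : List Bool) :
    2 * binValue c ≤ binValue (newCapital l b c) := by
  unfold newCapital
  rcases l with _ | ⟨b', _ | _⟩
  · simp
  · obtain rfl := h b' rfl
    simp
    omega
  · simp

theorem newCapital_win (b : Bool) (c : List Bool) :
    binValue (newCapital [b] b c) = 4 * binValue c := by
  simp [newCapital]; ring

/-! ### The enumeration of the words -/

/-- The final `true` is the leading digit, so the numeral has no superfluous zeros and `Nat.bits`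
returns it unchanged. -/
theorem bits_concat_true (u : List Bool) : Nat.bits (binValue (u ++ [true])) = u ++ [true] := by
  induction u with
  | nil => rfl
  | cons b u ih =>
    have h : binValue (b :: u ++ [true]) = Nat.bit b (binValue (u ++ [true])) := by
      rw [List.cons_append, binValue_cons, Nat.bit_val]; ring
    rw [h, Nat.bits_append_bit, ih]
    · rfl
    · intro h0
      simp [binValue_append] at h0

theorem exists_word_eq (w : List Bool) : ∃ n, word n = w := by
  have h0 : binValue (w.reverse ++ [true]) ≠ 0 := by simp [binValue_append]
  refine ⟨binValue (w.reverse ++ [true]) - 1, ?_⟩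
  rw [word, Nat.sub_add_cancel (Nat.one_le_iff_ne_zero.2 h0), bits_concat_true]
  simp

theorem two_pow_length_word_le (n : ℕ) : 2 ^ (word n).length ≤ n + 1 := by
  rw [← Nat.lt_size, ← Nat.size_eq_bits_len]
  have : 0 < (n + 1).bits.length := by
    rw [Nat.size_eq_bits_len]; exact Nat.size_pos.2 (Nat.succ_pos n)
  simp [word]
  omega

/-- Removing the leading digit turns the successor of numbers into the shortlex successor. When the
carry runs through all digits, the numeral gains a digit and the word becomes a longer block of
zeros. -/
theorem inc_dropLast_bits (n : ℕ) (hn : n ≠ 0) :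
    inc (Nat.bits n).dropLast = (Nat.bits (n + 1)).dropLast := by
  induction n using Nat.strong_induction_on with
  | _ n ih =>
    have hne : ∀ m, m ≠ 0 → (Nat.bits m) ≠ [] := by
      intro m hm h
      have := Nat.size_eq_bits_len m
      rw [h] at this
      exact hm (Nat.size_eq_zero.1 this.symm)
    rcases Nat.even_or_odd' n with ⟨k, rfl | rfl⟩
    · have hk : k ≠ 0 := by omega
      rw [Nat.bit0_bits k hk, Nat.bit1_bits, List.dropLast_cons_of_ne_nil (hne k hk),
        List.dropLast_cons_of_ne_nil (hne k hk), inc]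
    · rcases Nat.eq_zero_or_pos k with rfl | hk
      · rw [show 2 * 0 + 1 + 1 = 2 * 1 by rfl, Nat.bit0_bits 1 one_ne_zero]
        simp [inc]
      · rw [Nat.bit1_bits, show 2 * k + 1 + 1 = 2 * (k + 1) by ring,
          Nat.bit0_bits (k + 1) (by omega), List.dropLast_cons_of_ne_nil (hne k hk.ne'),
          List.dropLast_cons_of_ne_nil (hne (k + 1) (by omega)), inc, ih k (by omega) hk.ne']

theorem gamblers_fst {A : Language Bool} (σ : List Bool) :
    (gamblers A σ).1 = (word σ.length).reverse := by
  induction σ using List.reverseRecOn with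
  | nil => simp [gamblers, word]
  | append_singleton σ b ih =>
    rw [gamblers_concat, Gamblers.next, ih, word, word, List.reverse_reverse, List.reverse_reverse,
      inc_dropLast_bits _ (Nat.succ_ne_zero _)]
    simp

/-- Postfix notation parses correctly above any stack, which is the form that the induction on the
tree needs. -/
theorem exists_parse_eq (d : Data) : ∃ l, parse l = d := by
  have : ∀ d : Data, ∃ l : List Bool, ∀ s, l.foldl parseStep s = d :: s := by
    intro d
    induction d with
    | nil => exact ⟨[false], fun s => rfl⟩
    | cons a b iha ihb =>
      obtain ⟨l, hl⟩ := iha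
      obtain ⟨r, hr⟩ := ihb
      exact ⟨l ++ (r ++ [true]), fun s => by simp [hl, hr, parseStep, List.headI]⟩
  obtain ⟨l, hl⟩ := this d
  exact ⟨l, by rw [parse, hl]; rfl⟩

/-! ### The main result -/

section martingale

variable (A : Language Bool)

/-- The martingale that divides its initial capital among all the gamblers. -/
noncomputable def martingale (σ : List Bool) : ℚ :=
  binValue (total (gamblers A σ).2) / 2 ^ σ.length

theorem ratPolyTime_martingale : RatPolyTime A (martingale A) := by
  obtain ⟨M, j, h⟩ := (FP.martingaleCode (A := A)).exists_machine
  refine ⟨M, j, fun σ => ⟨_, ⟨false, total (gamblers A σ).2, σ.map (fun _ => false) ++ [true], rfl,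
    ?_⟩, h σ⟩⟩
  have : binValue (σ.map (fun _ => false) ++ [true]) = 2 ^ σ.length := by
    have h0 : binValue (σ.map fun _ => false) = 0 := by
      induction σ with
      | nil => rfl
      | cons b σ ih => rw [List.map_cons, binValue_cons, ih]; rfl
    rw [binValue_append, h0]
    simp
  rw [this]
  simp [martingale]

theorem isMartingale_martingale : IsMartingale fun σ => (martingale A σ : ℝ) := by
  refine ⟨fun σ => ?_, ?_, fun σ => ?_⟩
  · unfold martingale; positivity
  · simp [martingale, gamblers, total]
  -- The `1` in `total` is the reserve. For either bit it and the new gambler contribute `2` new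
  -- units, together `4`, matching four times the old reserve.
  · have key : binValue (total (gamblers A (σ ++ [false])).2) +
        binValue (total (gamblers A (σ ++ [true])).2) = 4 * binValue (total (gamblers A σ).2) := by
      simp only [gamblers_concat, binValue_total, Gamblers.next, List.map_cons, List.map_map,
        List.sum_cons]
      have : ∀ l : List (List Bool × List Bool),
          (l.map ((fun e => binValue e.2) ∘ fun e =>
            (e.1, newCapital (bet A (gamblers A σ) e.1) false e.2))).sum +
          (l.map ((fun e => binValue e.2) ∘ fun e =>
            (e.1, newCapital (bet A (gamblers A σ) e.1) true e.2))).sum =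
          4 * (l.map fun e => binValue e.2).sum := by
        intro l
        induction l with
        | nil => simp
        | cons e l ih =>
          have := newCapital_fair (bet A (gamblers A σ) e.1) e.2
          simp only [List.map_cons, List.sum_cons, Function.comp_apply] at ih ⊢
          omega
      have := this (gamblers A σ).2
      simp only [binValue_cons, binValue_nil, Bool.toNat_true]
      omega
    have key' : ((binValue (total (gamblers A (σ ++ [false])).2) : ℝ)) +
        binValue (total (gamblers A (σ ++ [true])).2) = 4 * binValue (total (gamblers A σ).2) := by
      exact_mod_cast key
    simp only [martingale, List.length_append, List.length_singleton]
    push_cast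
    rw [← add_div, key', pow_succ]
    field_simp
    ring

variable {A}

/-- If a gambler on a sequence never loses and wins infinitely often, the martingale succeeds. -/
theorem succeeds_of_wins {α : ℕ → Bool} {p : List Bool}
    (h₁ : ∀ n b, bet A (gamblers A (initSeg α n)) p = [b] → b = α n)
    (h₂ : ∀ n, ∃ m ≥ n, bet A (gamblers A (initSeg α m)) p = [α m]) :
    Succeeds (fun σ => (martingale A σ : ℝ)) α := by
  have hseg : ∀ n, initSeg α (n + 1) = initSeg α n ++ [α n] := fun n => by
    simp [initSeg, List.range_succ]
  have hlen : ∀ n, (initSeg α n).length = n := fun n => by simp [initSeg]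
  -- Programs are stored as reversed words, so the gambler with program `p` joins at the index of
  -- `p.reverse`.
  obtain ⟨k, hk⟩ := exists_word_eq p.reverse
  have hmem : ∀ n c, (p, c) ∈ (gamblers A (initSeg α n)).2 →
      (p, newCapital (bet A (gamblers A (initSeg α n)) p) (α n) c) ∈
        (gamblers A (initSeg α (n + 1))).2 := by
    intro n c hc
    rw [hseg, gamblers_concat]
    exact List.mem_cons_of_mem _ (List.mem_map.2 ⟨_, hc, rfl⟩)
  have hstart : (p, [true]) ∈ (gamblers A (initSeg α (k + 1))).2 := by
    rw [hseg, gamblers_concat, Gamblers.next, gamblers_fst, hlen, hk, List.reverse_reverse]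
    exact List.mem_cons_self
  -- The inequality says that the true capital `c / 2 ^ n` is at least `2 ^ K` times the initial `2
  -- ^ (-(k + 1))`. It persists since the gambler never loses, and `hgrow` raises `K` at each win.
  have hkeep : ∀ K n, (∃ c, (p, c) ∈ (gamblers A (initSeg α n)).2 ∧
      2 ^ (n + K) ≤ 2 ^ (k + 1) * binValue c) → ∀ i, ∃ c,
        (p, c) ∈ (gamblers A (initSeg α (n + i))).2 ∧
          2 ^ (n + i + K) ≤ 2 ^ (k + 1) * binValue c := by
    intro K n h i
    induction i with
    | zero => exact h
    | succ i ih =>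
      obtain ⟨c, hc, hle⟩ := ih
      refine ⟨_, hmem (n + i) c hc, ?_⟩
      have := Nat.mul_le_mul_left (2 ^ (k + 1)) (newCapital_le (h₁ (n + i)) c)
      rw [show n + (i + 1) + K = n + i + K + 1 by ring, pow_succ]
      linarith
  have hgrow : ∀ K, ∃ n, ∃ c, (p, c) ∈ (gamblers A (initSeg α n)).2 ∧
      2 ^ (n + K) ≤ 2 ^ (k + 1) * binValue c := by
    intro K
    induction K with
    | zero => exact ⟨k + 1, _, hstart, by simp⟩
    | succ K ih =>
      obtain ⟨n, hn⟩ := ih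
      obtain ⟨m, hm, hwin⟩ := h₂ n
      obtain ⟨i, rfl⟩ := Nat.exists_eq_add_of_le hm
      obtain ⟨c, hc, hle⟩ := hkeep K n hn i
      refine ⟨n + i + 1, _, hmem (n + i) c hc, ?_⟩
      rw [hwin, newCapital_win, show n + i + 1 + (K + 1) = n + i + K + 2 by ring, pow_add _ _ 2]
      linarith
  have hvalue : ∀ n c, (p, c) ∈ (gamblers A (initSeg α n)).2 →
      (binValue c : ℝ) / 2 ^ n ≤ (martingale A (initSeg α n) : ℝ) := by
    intro n c hc
    have h : binValue c ≤ binValue (total (gamblers A (initSeg α n)).2) := by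
      rw [binValue_total]
      have := List.single_le_sum (l := (gamblers A (initSeg α n)).2.map fun e => binValue e.2)
        (fun _ _ => Nat.zero_le _) (binValue c) (List.mem_map.2 ⟨_, hc, rfl⟩)
      omega
    simp only [martingale, hlen]
    push_cast
    gcongr
  -- Since the gambler's capital never decreases, the martingale even tends to infinity.
  refine Filter.Tendsto.limsup_eq ?_
  rw [EReal.tendsto_coe_nhds_top_iff]
  refine Filter.tendsto_atTop.2 fun x => ?_
  obtain ⟨K, hK⟩ := pow_unbounded_of_one_lt (x * 2 ^ (k + 1)) (one_lt_two : (1 : ℝ) < 2)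
  obtain ⟨n, hn⟩ := hgrow K
  filter_upwards [Filter.eventually_ge_atTop n] with m hm
  obtain ⟨i, rfl⟩ := Nat.exists_eq_add_of_le hm
  obtain ⟨c, hc, hle⟩ := hkeep K n hn i
  refine le_trans ?_ (hvalue _ c hc)
  have hle' : (2 : ℝ) ^ (n + i + K) ≤ 2 ^ (k + 1) * binValue c := by exact_mod_cast hle
  rw [le_div_iff₀ (by positivity)]
  rw [pow_add _ (n + i)] at hle'
  have h3 : x * 2 ^ (k + 1) * 2 ^ (n + i) ≤ 2 ^ K * 2 ^ (n + i) := by gcongr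
  have h4 : 2 ^ (k + 1) * (x * 2 ^ (n + i)) ≤ 2 ^ (k + 1) * (binValue c : ℝ) := by linarith
  exact le_of_mul_le_mul_left h4 (by positivity)

theorem exists_pow_add_lt_two_pow (j : ℕ) : ∃ m, ∀ n ≥ m, n ^ j + j + 1 ≤ 2 ^ n := by
  have h1 := (isLittleO_pow_const_const_pow_of_one_lt (R := ℝ) j (one_lt_two : (1 : ℝ) < 2)).bound
    (show (0 : ℝ) < 1 / 2 by norm_num)
  have h2 : ∀ᶠ n : ℕ in Filter.atTop, 2 * (j + 1) ≤ 2 ^ n := by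
    filter_upwards [Filter.eventually_ge_atTop (2 * (j + 1))] with n hn
    exact hn.trans Nat.lt_two_pow_self.le
  obtain ⟨m, hm⟩ := Filter.eventually_atTop.1 (h1.and h2)
  refine ⟨m, fun n hn => ?_⟩
  obtain ⟨h3, h4⟩ := hm n hn
  rw [Real.norm_of_nonneg (by positivity), Real.norm_of_nonneg (by positivity)] at h3
  have h5 : (2 * n ^ j : ℝ) ≤ 2 ^ n := by linarith
  have h6 : 2 * n ^ j ≤ 2 ^ n := by exact_mod_cast h5
  omega

/-- The infinitely many wins need only this consequence of uniformity: a long block of zeros extends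
to a word in the domain. -/
theorem IsUniform.exists_long {φ : List Bool →. Bool} (h : IsUniform φ) (m : ℕ) :
    ∃ w, m ≤ w.length ∧ (φ w).Dom := by
  obtain ⟨k, -, hk⟩ := h
  obtain ⟨z, -, hz⟩ := hk (List.replicate (max k m) false) (by simp)
  exact ⟨_, by simp; omega, hz⟩

theorem succeeds_of_mem_UFP {f : List Bool → Bool} (hf : f ∈ UFP A) :
    Succeeds (fun σ => (martingale A σ : ℝ)) (charSeq f) := by
  obtain ⟨-, φ, ⟨M, hM, j, hj⟩, hφ, hext⟩ := hf
  obtain ⟨p, hp⟩ := exists_parse_eq M.table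
  have hbet : ∀ n b, bet A (gamblers A (initSeg (charSeq f) n)) p = [b] ↔
      M.Outputs A (word n) [b] n := by
    intro n b
    have hlen : (initSeg (charSeq f) n).length = n := by simp [initSeg]
    rw [bet, hp, gamblers_fst, List.reverse_reverse, sim_eq_iff, Data.spine_toData,
      (gamblers_bound _).2.1, hlen]
  refine succeeds_of_wins (p := p) (fun n b h => ?_) fun n => ?_
  -- No bet is lost: any one-letter output of `M` is a value of `φ`, even on a run that is not
  -- time-bounded.
  · exact (hext _ b ((hM _ b).2 ⟨_, (hbet n b).1 h⟩)).symm
  · obtain ⟨m, hm⟩ := exists_pow_add_lt_two_pow j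
    obtain ⟨w, hw, hdom⟩ := hφ.exists_long (max n m)
    obtain ⟨i, rfl⟩ := exists_word_eq w
    have h1 := two_pow_length_word_le i
    -- With `h1` this gives `|w| ^ j + j + 1 ≤ 2 ^ |w| ≤ i + 1`, so the clock `i` suffices for `M`
    -- to halt.
    have h2 := hm (word i).length (by omega)
    have h3 : (word i).length < 2 ^ (word i).length := Nat.lt_two_pow_self
    refine ⟨i, by omega, (hbet i _).2 ?_⟩
    have h4 := Part.get_mem hdom
    have h5 : charSeq f i = (φ (word i)).get hdom := hext _ _ h4
    rw [h5]
    obtain ⟨t, ht, h6⟩ := hj _ _ h4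
    exact ⟨t, by omega, h6⟩

end martingale

end OracleComplexity

theorem mainTheorem2 (A : Language Bool) :
    OracleComplexity.MeasureZeroInStrictExp A (OracleComplexity.UFP A) := by
  refine ⟨fun f hf => hf.1, OracleComplexity.martingale A,
    OracleComplexity.ratPolyTime_martingale A, OracleComplexity.isMartingale_martingale A, ?_⟩
  rintro _ ⟨f, hf, rfl⟩
  exact OracleComplexity.succeeds_of_mem_UFP hf
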